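/- There is no weak termination-preserving encoding of Turing machines into $\mathrm{CHR}_1(C)$ (single-headed CHR without function symbols of positive arity) under the abstract semantics $\omega_o$. That is, there is no computable function $f$ that maps every pair $(Z,D)$, where $Z$ is a (deterministic, one-tape) Turing machine and $D$ is an initial instantaneous description for $Z$, to a pair $(P,G)$, where $P$ is a $\mathrm{CHR}_1(C)$ program and $G$ is a goal, such that for all $(Z,D)$, with $(P,G)=f(Z,D)$: the machine $Z$ started with $D$ terminates if and only if $G$ has at least one terminating computation in $P$. Here the notions are as follows. Terms are variables or constants (of each there are countably many). The only built-in constraints are equations between terms, interpreted as equality on the Herbrand universe, i.e. on the set of constants; $\mathcal{CT}\models$ denotes truth in this structure. A CHR constraint is an atom $p(t_1,\dots,t_n)$ with $p$ a user-defined predicate. A goal is a finite multiset of built-in and CHR constraints. A program is a finite sequence of rules $H^k\backslash H^h\Longleftrightarrow g\mid B$, where $H^k,H^h$ are finite multisets of CHR constraints, not both empty, the guard $g$ is a finite conjunction of equations, and the body $B$ is a finite multiset of constraints. The program is in $\mathrm{CHR}_1(C)$ if for each of its rules $H^k$ and $H^h$ together contain exactly one atom. Configurations are tuples $\langle G,S,B\rangle_n$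 with $G$ a goal, $S$ a set of CHR constraints $c\#i$ labelled with identifiers $i$, $B$ a conjunction of equations, and $n$ the next free identifier. The transitions are: * **Solve:** $\langle\{e\}\uplus G,S,B\rangle_n\to\langle G,S,e\wedge B\rangle_n$ for an equation $e$; * **Introduce:** $\langle\{c\}\uplus G,S,B\rangle_n\to\langle G,\{c\#n\}\cup S,B\rangle_{n+1}$ for a CHR constraint $c$; * **Apply:** $\langle G,H_1\cup H_2\cup S,B\rangle_n\to\langle C\uplus G,H_1\cup S,\theta\wedge B\rangle_n$, if $H_1'\backslash H_2'\Longleftrightarrow g\mid C$ is a rule of $P$ with its variables $\bar y$ renamed apart from the configuration, the atoms of $H_1',H_2'$ correspond one to one to the constraints in $H_1,H_2$ with the same predicates, $\theta$ is the conjunction of the equations between corresponding arguments, and $\mathcal{CT}\models B\rightarrow\exists\bar y\,(\theta\wedge g)$. The initial configuration for $G$ is $\langle G,\emptyset,\mathit{true}\rangle_1$. A configuration is final if its built-in store $B$ is unsatisfiable, or if its goal is empty and no rule is applicable. A computation for $G$ in $P$ is a sequence of transitions from the initial configuration; it is terminating if it is finite and ends in a final configuration. -/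

import Mathlib

/-! ## Syntax of CHR(C)

The signature has countably many variables, constants and predicate symbols, all named by natural
numbers, and no function symbol of positive arity.  A predicate is determined by its name together
with its arity (the number of arguments), as usual in logic programming. -/

namespace CHR

/-- Names of variables. -/
abbrev Var := ℕ

/-- Constants.  As there are no other function symbols, this is also the Herbrand universe. -/
abbrev Const := ℕ

/-- A term is a variable or a constant. -/
inductive Term where
  | var (x : Var)
  | const (a : Const)

/-- A built-in constraint: an equation between two terms. -/
structure Equation where
  lhs : Term
  rhs : Term

/-- A CHR (user-defined) constraint `p(t₁, …, tₙ)`. -/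
structure Atom where
  pred : ℕ
  args : List Term

/-- A constraint is a built-in constraint or a CHR constraint. -/
inductive Constraint where
  | builtin (e : Equation)
  | chr (a : Atom)

/-- A simpagation rule `keep \ remove ⟺ guard | body`.  It is a simplification rule if `keep` is
empty, and a propagation rule if `remove` is empty.  The guard is a conjunction of equations (the
empty conjunction is `true`).  Lists stand for multisets: the transitions below do not depend on
the order. -/
structure Rule where
  keep : List Atom
  remove : List Atom
  guard : List Equation
  body : List Constraint

/-- A program is a sequence of rules. -/
abbrev Program := List Rule

/-- A goal is a multiset of constraints, given by a list whose order is immaterial. -/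
abbrev Goal := List Constraint

/-- The heads of the rule contain exactly one atom altogether. -/
def Rule.IsSingleHeaded (r : Rule) : Prop := (r.keep ++ r.remove).length = 1

/-- The program belongs to the single-headed fragment CHR₁(C). -/
def Program.IsSingleHeaded (P : Program) : Prop := ∀ r ∈ P, r.IsSingleHeaded

/-! ### Effective coding of programs and goals -/

def termEquiv : Term ≃ Var ⊕ Const where
  toFun
    | .var x => Sum.inl x
    | .const a => Sum.inr a
  invFun
    | Sum.inl x => .var x
    | Sum.inr a => .const a
  left_inv t := by cases t <;> rfl
  right_inv t := by cases t <;> rfl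

instance : Primcodable Term := Primcodable.ofEquiv _ termEquiv

def equationEquiv : Equation ≃ Term × Term where
  toFun e := (e.lhs, e.rhs)
  invFun p := ⟨p.1, p.2⟩
  left_inv _ := rfl
  right_inv _ := rfl

instance : Primcodable Equation := Primcodable.ofEquiv _ equationEquiv

def atomEquiv : Atom ≃ ℕ × List Term where
  toFun a := (a.pred, a.args)
  invFun p := ⟨p.1, p.2⟩
  left_inv _ := rfl
  right_inv _ := rfl

instance : Primcodable Atom := Primcodable.ofEquiv _ atomEquiv

def constraintEquiv : Constraint ≃ Equation ⊕ Atom where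
  toFun
    | .builtin e => Sum.inl e
    | .chr a => Sum.inr a
  invFun
    | Sum.inl e => .builtin e
    | Sum.inr a => .chr a
  left_inv c := by cases c <;> rfl
  right_inv c := by cases c <;> rfl

instance : Primcodable Constraint := Primcodable.ofEquiv _ constraintEquiv

def ruleEquiv : Rule ≃ List Atom × List Atom × List Equation × List Constraint where
  toFun r := (r.keep, r.remove, r.guard, r.body)
  invFun p := ⟨p.1, p.2.1, p.2.2.1, p.2.2.2⟩
  left_inv _ := rfl
  right_inv _ := rfl

instance : Primcodable Rule := Primcodable.ofEquiv _ ruleEquiv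

/-! ### Variables and renamings -/

/-- The variables of a term. -/
def Term.vars : Term → List Var
  | .var x => [x]
  | .const _ => []

/-- The variables of an equation. -/
def Equation.vars (e : Equation) : List Var := e.lhs.vars ++ e.rhs.vars

/-- The variables of a CHR constraint. -/
def Atom.vars (a : Atom) : List Var := a.args.flatMap Term.vars

/-- The variables of a constraint. -/
def Constraint.vars : Constraint → List Var
  | .builtin e => e.vars
  | .chr a => a.vars

/-- The variables of a rule (heads, guard and body). -/
def Rule.vars (r : Rule) : List Var :=
  r.keep.flatMap Atom.vars ++ r.remove.flatMap Atom.vars ++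
    r.guard.flatMap Equation.vars ++ r.body.flatMap Constraint.vars

/-- Renaming of variables in a term. -/
def Term.rename (ρ : Var → Var) : Term → Term
  | .var x => .var (ρ x)
  | .const a => .const a

/-- Renaming of variables in an equation. -/
def Equation.rename (ρ : Var → Var) (e : Equation) : Equation :=
  ⟨e.lhs.rename ρ, e.rhs.rename ρ⟩

/-- Renaming of variables in a CHR constraint. -/
def Atom.rename (ρ : Var → Var) (a : Atom) : Atom :=
  ⟨a.pred, a.args.map (Term.rename ρ)⟩

/-- Renaming of variables in a constraint. -/
def Constraint.rename (ρ : Var → Var) : Constraint → Constraint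
  | .builtin e => .builtin (e.rename ρ)
  | .chr a => .chr (a.rename ρ)

/-- Renaming of variables in a rule. -/
def Rule.rename (ρ : Var → Var) (r : Rule) : Rule where
  keep := r.keep.map (Atom.rename ρ)
  remove := r.remove.map (Atom.rename ρ)
  guard := r.guard.map (Equation.rename ρ)
  body := r.body.map (Constraint.rename ρ)

/-! ### The constraint theory: equality on the Herbrand universe -/

/-- A valuation of the variables in the Herbrand universe. -/
abbrev Valuation := Var → Const

/-- The value of a term. -/
def Term.eval (v : Valuation) : Term → Const
  | .var x => v x
  | .const a => a

/-- The valuation satisfies a conjunction of equations. -/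
def Valuation.Satisfies (v : Valuation) (B : List Equation) : Prop :=
  ∀ e ∈ B, e.lhs.eval v = e.rhs.eval v

/-- The conjunction `B` is equivalent to `false`. -/
def Inconsistent (B : List Equation) : Prop := ∀ v : Valuation, ¬ v.Satisfies B

/-- `CT ⊨ B → ∃ ys. E`, for conjunctions of equations `B` and `E`. -/
def EntailsExists (B : List Equation) (ys : List Var) (E : List Equation) : Prop :=
  ∀ v : Valuation, v.Satisfies B →
    ∃ w : Valuation, (∀ x, x ∉ ys → w x = v x) ∧ w.Satisfies E

/-! ### The abstract operational semantics -/

/-- An identified CHR constraint `c#i`. -/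
abbrev IdAtom := Atom × ℕ

/-- A configuration `⟨G, S, B⟩ₙ`: the goal, the CHR store, the built-in store (a conjunction of
equations) and the next free identifier.  The elements of `S` are distinct in every configuration
that is reachable from an initial one, since their identifiers are. -/
structure Config where
  goal : Multiset Constraint
  store : Multiset IdAtom
  builtins : List Equation
  next : ℕ

/-- The variable `x` occurs in the configuration. -/
def Config.HasVar (s : Config) (x : Var) : Prop :=
  (∃ c ∈ s.goal, x ∈ c.vars) ∨ (∃ c ∈ s.store, x ∈ c.1.vars) ∨ (∃ e ∈ s.builtins, x ∈ e.vars)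

/-- Two CHR constraints with the same predicate symbol (name and arity). -/
def Atom.SamePred (h c : Atom) : Prop := h.pred = c.pred ∧ h.args.length = c.args.length

/-- The equations between corresponding arguments of two CHR constraints. -/
def Atom.argEqs (h c : Atom) : List Equation := List.zipWith Equation.mk h.args c.args

/-- The matching `θ`, as a conjunction of equations, of a sequence of head atoms with a sequence of
CHR constraints. -/
def matchEqs (hs cs : List Atom) : List Equation := (List.zipWith Atom.argEqs hs cs).flatten

/-- The transitions of the abstract semantics.

In `apply`, the rule `r` is renamed apart from the configuration by `ρ`, its heads are matched with
the identified constraints `K` (kept) and `R` (removed), and the built-in store entails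
`∃ ys (θ ∧ g)`, where `ys` are the variables of the renamed rule.  Matching is thus modulo the
built-in store, and it instantiates only variables of the rule. -/
inductive Step (P : Program) : Config → Config → Prop
  | solve (e : Equation) (G : Multiset Constraint) (S : Multiset IdAtom) (B : List Equation)
      (n : ℕ) :
      Step P ⟨Constraint.builtin e ::ₘ G, S, B, n⟩ ⟨G, S, e :: B, n⟩
  | introduce (a : Atom) (G : Multiset Constraint) (S : Multiset IdAtom) (B : List Equation)
      (n : ℕ) :
      Step P ⟨Constraint.chr a ::ₘ G, S, B, n⟩ ⟨G, (a, n) ::ₘ S, B, n + 1⟩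
  | apply (r : Rule) (ρ : Var → Var) (K R : List IdAtom)
      (G : Multiset Constraint) (S : Multiset IdAtom) (B : List Equation) (n : ℕ)
      (mem : r ∈ P) (inj : Function.Injective ρ)
      (apart : ∀ x ∈ (r.rename ρ).vars, ¬ Config.HasVar ⟨G, ↑K + ↑R + S, B, n⟩ x)
      (matchKeep : List.Forall₂ Atom.SamePred (r.rename ρ).keep (K.map Prod.fst))
      (matchRemove : List.Forall₂ Atom.SamePred (r.rename ρ).remove (R.map Prod.fst))
      (entails : EntailsExists B (r.rename ρ).vars
        (matchEqs (r.rename ρ).keep (K.map Prod.fst) ++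
          matchEqs (r.rename ρ).remove (R.map Prod.fst) ++ (r.rename ρ).guard)) :
      Step P ⟨G, ↑K + ↑R + S, B, n⟩
        ⟨↑(r.rename ρ).body + G, ↑K + S,
          matchEqs (r.rename ρ).keep (K.map Prod.fst) ++
            matchEqs (r.rename ρ).remove (R.map Prod.fst) ++ B, n⟩

/-- The initial configuration `⟨G, ∅, true⟩₁` of a goal. -/
def initial (G : Goal) : Config := ⟨↑G, 0, [], 1⟩

/-- Final configurations: failed ones, and those with empty goal in which no rule is applicable
(with an empty goal, `apply` is the only transition that could be taken). -/
def Config.IsFinal (P : Program) (s : Config) : Prop :=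
  Inconsistent s.builtins ∨ (s.goal = 0 ∧ ∀ s', ¬ Step P s s')

/-- The goal `G` has at least one terminating computation in the program `P`, that is, a finite
computation that ends in a final configuration. -/
def HasTerminatingComputation (P : Program) (G : Goal) : Prop :=
  ∃ s, Relation.ReflTransGen (Step P) (initial G) s ∧ s.IsFinal P

/-! ### Turing machines -/

def dirEquiv : Turing.Dir ≃ Bool where
  toFun
    | .left => false
    | .right => true
  invFun
    | false => .left
    | true => .right
  left_inv d := by cases d <;> rfl
  right_inv b := by cases b <;> rfl

instance : Primcodable Turing.Dir := Primcodable.ofEquiv _ dirEquiv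

def stmtEquiv : Turing.TM0.Stmt ℕ ≃ Turing.Dir ⊕ ℕ where
  toFun
    | .move d => Sum.inl d
    | .write a => Sum.inr a
  invFun
    | Sum.inl d => .move d
    | Sum.inr a => .write a
  left_inv s := by cases s <;> rfl
  right_inv s := by cases s <;> rfl

instance : Primcodable (Turing.TM0.Stmt ℕ) := Primcodable.ofEquiv _ stmtEquiv

/-- A (deterministic, one-tape) Turing machine, given by its finite transition table: the entry
`((q, a), (q', s))` says that in state `q`, reading the symbol `a`, the machine goes to the state
`q'` and either moves its head or writes a symbol, according to `s`.  States and symbols are natural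
numbers; the initial state and the blank symbol are `0`. -/
abbrev TuringMachine := List ((ℕ × ℕ) × (ℕ × Turing.TM0.Stmt ℕ))

/-- The machine described by a table; it halts where the table has no entry (and the first entry
counts if there are several). -/
def TuringMachine.toMachine (Z : TuringMachine) : Turing.TM0.Machine ℕ ℕ :=
  fun q a => List.lookup (q, a) Z

/-- The machine terminates when started in its initial state on the tape that contains the word `D`,
surrounded by blanks, with the head on the first symbol of `D`. -/
def TuringMachine.Halts (Z : TuringMachine) (D : List ℕ) : Prop :=
  (Turing.TM0.eval Z.toMachine D).Dom

/-- `f` maps a Turing machine `Z` and an initial instantaneous description `D` to a program and a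
goal such that `Z` started with `D` terminates if and only if the goal has at least one terminating
computation in the program. -/
def IsWeakTerminationPreserving (f : TuringMachine × List ℕ → Program × Goal) : Prop :=
  ∀ (Z : TuringMachine) (D : List ℕ),
    Z.Halts D ↔ HasTerminatingComputation (f (Z, D)).1 (f (Z, D)).2

end CHR

/-!
The set of non-halting inputs is not recursively enumerable, already for one fixed Turing machine
(`exists_universal_machine`), whereas the goals *without* a terminating computation in a
single-headed program are recursively enumerable (`rePred_not_hasTerminatingComputation`).  An
encoding `f` would turn the latter fact into an enumeration of the non-halting inputs.

The second fact rests on the tree-like form of single-headed computations.  Distinct CHR constraints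
never react with each other; they interact only through the built-in store.  What is to become of
one constraint is described by a `Plan`, a tree of rules.  Once the plans of all constraints are
fixed, firing their rules is a monotone and confluent process, so that the order does not matter.
It is determined by its resting points: the valuations such that all enabled rules of the plans add
only equations that are satisfied already.  All rules of the plans are fired, unless the store
fails, if and only if no resting point leaves a rule of a plan disabled.  The computation then fails
if and only if there is no resting point.  Otherwise it ends in a final configuration if and only if
some resting point enables no rule of the program for any constraint that is still present.

Whether a valuation is a resting point depends on a plan only through a `Summary`, the behaviour of
the plan as a function of the values of the arguments of its constraint, and the summary of a tree
is obtained from those of its subtrees (`nodeSummary`).  That plans describe exactly the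
terminating computations is `hasTerminatingComputation_iff`: a step preserves and reflects the
property that plans complete (`completes_apply`), because a consistent store has a most general
solution (`exists_generic`), for which a rule is enabled only if the store entails that it is
applicable.

Summaries are invariant under the permutations of the constants that do not occur in the program, so
that a finite universe suffices to describe them (`Plan.summary_agreeOn_finite`), and only finitely
many summaries exist.  A finite list of summaries that is closed under the construction of plans,
none of which makes the goal terminate, is a certificate of non-termination
(`not_hasTerminatingComputation_iff`), and it can be checked effectively (`primrecPred_refutes`).
-/


/-! ### Undecidability of the halting problem for Turing machines given by tables -/

namespace CHR

open Turing

/-- Finitely many states can be renamed into natural numbers, invertibly and with the default state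
sent to `0`. The two maps are in the form that `TM0.Machine.map` asks for. -/
theorem exists_pointedMap_nat {X : Type*} [Inhabited X] {S : Set X} (hS : S.Finite)
    (h0 : default ∈ S) : ∃ (g : PointedMap X ℕ) (g' : PointedMap ℕ X), ∀ q ∈ S, g' (g q) = q := by
  classical
  obtain ⟨f, hf⟩ := Set.countable_iff_exists_injOn.1 hS.countable
  let g : X → ℕ := fun x => if x = default then 0 else f x + 1
  have hg : Set.InjOn g S := by
    intro x hx y hy hxy
    by_cases h1 : x = default <;> by_cases h2 : y = default <;> simp [g, h1, h2] at hxy ⊢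
    exact hf hx hy hxy
  have hinv : ∀ q ∈ S, Function.invFunOn g S (g q) = q := fun q hq => hg.leftInvOn_invFunOn hq
  have g0 : g default = 0 := by simp [g]
  refine ⟨⟨g, g0⟩, ⟨Function.invFunOn g S, ?_⟩, hinv⟩
  have := hinv _ h0
  rwa [g0] at this

theorem lookup_filterMap {α β : Type*} [BEq α] [LawfulBEq α] (F : α → Option β) {L : List α}
    {k : α} (hk : k ∈ L) : (L.filterMap fun x => (F x).map (x, ·)).lookup k = F k := by
  induction L with
  | nil => simp at hk
  | cons x L ih =>
    by_cases hx : k = x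
    · subst hx
      by_cases hL : k ∈ L
      · cases h : F k with
        | none => simp [h, ih hL]
        | some b => simp [h]
      · cases h : F k with
        | none =>
          simp only [List.filterMap_cons, h, Option.map_none, List.lookup_eq_none_iff]
          intro p hp
          obtain ⟨y, hy, hy'⟩ := List.mem_filterMap.1 hp
          cases hF : F y with
          | none => simp [hF] at hy'
          | some c =>
            simp only [hF, Option.map_some, Option.some.injEq] at hy'
            subst hy'
            have : k ≠ y := fun e => hL (e ▸ hy)
            simpa using this
        | some b => simp [h]
    · have hL : k ∈ L := by simpa [hx] using hk
      cases h : F x with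
      | none => simp [h, ih hL]
      | some b =>
        have : (k == x) = false := by simpa using hx
        simp [List.lookup_cons, h, ih hL, this]

/-- A machine with a finite alphabet and a finite set of supporting states is given by a table,
after numbering its symbols and states. -/
theorem exists_table {Γ Λ : Type*} [Inhabited Γ] [Finite Γ] [Inhabited Λ] (M : TM0.Machine Γ Λ)
    {S : Set Λ} (hS : S.Finite) (ss : TM0.Supports M S) :
    ∃ (e : Γ → ℕ) (Z : TuringMachine), ∀ l, Z.Halts (l.map e) ↔ (TM0.eval M l).Dom := by
  obtain ⟨f₁, f₂, hf⟩ := exists_pointedMap_nat (X := Γ) Set.finite_univ (Set.mem_univ _)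
  obtain ⟨g₁, g₂, hg⟩ := exists_pointedMap_nat hS ss.1
  let M' := M.map f₁ f₂ g₁ g₂
  let L : List (ℕ × ℕ) := hS.toFinset.toList.flatMap fun q =>
    (Set.finite_univ (α := Γ)).toFinset.toList.map fun a => (g₁ q, f₁ a)
  let Z : TuringMachine := L.filterMap fun x => (M' x.1 x.2).map (x, ·)
  have hZ : ∀ q ∈ S, ∀ a, Z.toMachine (g₁ q) (f₁ a) = M' (g₁ q) (f₁ a) := by
    intro q hq a
    refine lookup_filterMap (fun x : ℕ × ℕ => M' x.1 x.2) ?_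
    simp only [L, List.mem_flatMap, Finset.mem_toList, Set.Finite.mem_toFinset, List.mem_map]
    exact ⟨q, hq, a, by simp, rfl⟩
  have hstep : ∀ c : TM0.Cfg Γ Λ, c.q ∈ S →
      (TM0.step M c).map (TM0.Cfg.map f₁ g₁) = TM0.step Z.toMachine (TM0.Cfg.map f₁ g₁ c) := by
    rintro ⟨q, T⟩ h
    rw [TM0.Machine.map_step M f₁ f₂ g₁ g₂ (fun a => hf a (Set.mem_univ _)) hg _ h]
    have := hZ q h T.1
    simp only [TM0.step, TM0.Cfg.map, Tape.map_fst]
    rw [this]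
  have hresp : StateTransition.Respects (TM0.step M) (TM0.step Z.toMachine)
      fun a b => a.q ∈ S ∧ TM0.Cfg.map f₁ g₁ a = b := by
    rintro c _ ⟨cs, rfl⟩
    have h := hstep c cs
    cases e : TM0.step M c with
    | none => rw [e] at h; exact h.symm
    | some c' =>
      rw [e] at h
      exact ⟨_, ⟨TM0.step_supports M ss e cs, rfl⟩, Relation.TransGen.single h.symm⟩
  refine ⟨f₁, Z, fun l => ?_⟩
  exact StateTransition.tr_eval_dom hresp ⟨ss.1, TM0.map_init f₁ g₁ l⟩

theorem trNat_posNum (p : PosNum) : PartrecToTM2.trNat (p : ℕ) = PartrecToTM2.trPosNum p := by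
  rw [PartrecToTM2.trNat, PosNum.of_to_nat]
  rfl

/-- The recursion on the binary digits, least significant digit first; the leading digit of a
positive number is always `bit1`. -/
theorem trNat_eq (n : ℕ) : PartrecToTM2.trNat n = if n = 0 then [] else
    (if n / 2 = 0 then .bit1 else if n % 2 = 0 then .bit0 else .bit1) ::
      PartrecToTM2.trNat (n / 2) := by
  by_cases hn : n = 0
  · simp [hn]
  obtain ⟨p, rfl⟩ : ∃ p : PosNum, (p : ℕ) = n := by
    rcases h : (n : Num) with _ | p
    · exact absurd (by rw [← Num.to_of_nat n, h]; rfl) hn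
    · exact ⟨p, by rw [← Num.to_of_nat n, h]; rfl⟩
  rw [if_neg hn, trNat_posNum]
  cases p with
  | one => simp [PartrecToTM2.trPosNum]
  | bit0 p =>
    have h : ((p.bit0 : PosNum) : ℕ) = 2 * (p : ℕ) := by simp [two_mul]
    have h0 := p.to_nat_pos
    rw [h, Nat.mul_div_cancel_left _ two_pos, trNat_posNum, if_neg h0.ne', if_pos (by simp)]
    rfl
  | bit1 p =>
    have h : ((p.bit1 : PosNum) : ℕ) = 2 * (p : ℕ) + 1 := by simp [two_mul]
    have h0 := p.to_nat_pos
    have h1 : (2 * (p : ℕ) + 1) / 2 = p := by omega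
    rw [h, h1, trNat_posNum, if_neg h0.ne', if_neg (by omega)]
    rfl

theorem primrec_trNat_map (d : PartrecToTM2.Γ' → ℕ) :
    Primrec fun n => (PartrecToTM2.trNat n).map d := by
  let g : Unit → List (List ℕ) → Option (List ℕ) := fun _ L =>
    if L.length = 0 then some [] else
      (L[L.length / 2]?).map fun l => (if L.length / 2 = 0 then d .bit1 else
        if L.length % 2 = 0 then d .bit0 else d .bit1) :: l
  have hlen : Primrec fun x : Unit × List (List ℕ) => x.2.length :=
    Primrec.list_length.comp Primrec.snd
  have hdiv : Primrec fun x : Unit × List (List ℕ) => x.2.length / 2 :=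
    Primrec.nat_div.comp hlen (Primrec.const 2)
  have hmod : Primrec fun x : Unit × List (List ℕ) => x.2.length % 2 :=
    Primrec.nat_mod.comp hlen (Primrec.const 2)
  have hg : Primrec₂ g := by
    refine Primrec.ite (Primrec.eq.comp hlen (Primrec.const 0)) (Primrec.const _) ?_
    refine Primrec.option_map (Primrec.list_getElem?.comp Primrec.snd hdiv) ?_
    refine Primrec.list_cons.comp ?_ Primrec.snd
    refine Primrec.ite (Primrec.eq.comp (hdiv.comp Primrec.fst) (Primrec.const 0))
      (Primrec.const _) ?_
    exact Primrec.ite (Primrec.eq.comp (hmod.comp Primrec.fst) (Primrec.const 0))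
      (Primrec.const _) (Primrec.const _)
  refine (Primrec.nat_strong_rec (fun (_ : Unit) n => (PartrecToTM2.trNat n).map d) hg ?_).comp
    (Primrec.const ()) Primrec.id
  intro _ n
  by_cases hn : n = 0
  · simp [g, hn]
  · have : n / 2 < n := by omega
    rw [trNat_eq n, if_neg hn]
    simp only [g, List.length_map, List.length_range, if_neg hn, List.getElem?_map,
      List.getElem?_range this, Option.map_some, List.map_cons]
    split_ifs <;> rfl

theorem trInit_concat_map {K : Type*} [DecidableEq K] {Γ : K → Type*}
    (e : TM2to1.Γ' K Γ → ℕ) (k : K) (L : List (Γ k)) (a : Γ k) :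
    (TM2to1.trInit k (L ++ [a])).map e = e (true, Function.update (fun _ => none) k (some a)) ::
      (L.map fun a => e (false, Function.update (fun _ => none) k (some a))).reverse := by
  rw [TM2to1.trInit, List.reverse_append, ← List.map_reverse]
  exact congrArg (List.cons _) (List.map_map (l := L.reverse))

instance : Finite PartrecToTM2.K' :=
  Finite.of_surjective (fun i : Fin 4 => match i with
    | 0 => PartrecToTM2.K'.main
    | 1 => .rev
    | 2 => .aux
    | 3 => .stack) fun k => by
      cases k
      exacts [⟨0, rfl⟩, ⟨1, rfl⟩, ⟨2, rfl⟩, ⟨3, rfl⟩]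

/-- There is one Turing machine whose halting problem is as hard as the one for partial recursive
functions: it simulates an evaluator of codes, and its input is a code in binary notation. -/
theorem exists_universal_machine : ∃ (Z : TuringMachine) (D : Nat.Partrec.Code → List ℕ),
    Computable D ∧ ∀ c, Z.Halts (D c) ↔ (c.eval 0).Dom := by
  have hp : Partrec fun n : ℕ => (Denumerable.ofNat Nat.Partrec.Code n).eval 0 :=
    Nat.Partrec.Code.eval_part.comp (Computable.ofNat _) (Computable.const 0)
  obtain ⟨c, hc⟩ := ToPartrec.Code.exists_code (Nat.Partrec'.part_iff₁.2 hp)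
  let : Inhabited PartrecToTM2.Λ' := ⟨PartrecToTM2.trNormal c .halt⟩
  have ss := TM1to0.tr_supports _ (TM2to1.tr_supports _ (PartrecToTM2.tr_supports c .halt))
  have : Finite (TM2to1.Γ' PartrecToTM2.K' fun _ => PartrecToTM2.Γ') :=
    inferInstanceAs (Finite (Bool × (PartrecToTM2.K' → Option PartrecToTM2.Γ')))
  obtain ⟨e, Z, hZ⟩ := exists_table _ (Finset.finite_toSet _) ss
  refine ⟨Z, fun n => (TM2to1.trInit PartrecToTM2.K'.main
    (PartrecToTM2.trList [Encodable.encode n])).map e, ?_, fun n => ?_⟩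
  · have h := Primrec.list_cons.comp (Primrec.const (e (true, Function.update (fun _ => none)
      PartrecToTM2.K'.main (some PartrecToTM2.Γ'.cons))))
      (Primrec.list_reverse.comp ((primrec_trNat_map fun a => e (false,
        Function.update (fun _ => none) PartrecToTM2.K'.main (some a))).comp
        (Primrec.encode (α := Nat.Partrec.Code))))
    refine h.to_comp.of_eq fun n => ?_
    exact (trInit_concat_map (Γ := fun _ => PartrecToTM2.Γ') e PartrecToTM2.K'.main
      (PartrecToTM2.trNat (Encodable.encode n)) PartrecToTM2.Γ'.cons).symm
  · rw [hZ, TM1to0.tr_eval]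
    refine (TM2to1.tr_eval_dom _ _ _).trans ?_
    have h1 := PartrecToTM2.tr_eval c [Encodable.encode n]
    have h2 := hc ⟨[Encodable.encode n], rfl⟩
    have h3 : (TM2.init PartrecToTM2.K'.main (PartrecToTM2.trList [Encodable.encode n]) :
        TM2.Cfg (fun _ : PartrecToTM2.K' => PartrecToTM2.Γ') PartrecToTM2.Λ'
          (Option PartrecToTM2.Γ')) = PartrecToTM2.init c [Encodable.encode n] := by
      unfold TM2.init PartrecToTM2.init
      congr 1
      funext k
      cases k <;> simp [PartrecToTM2.K'.elim]
    change (StateTransition.eval (TM2.step PartrecToTM2.tr) (TM2.init _ _)).Dom ↔ _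
    rw [h3, h1, h2]
    simp [List.Vector.head]

end CHR

/-! ### Plans and their summaries -/

namespace CHR

/-- A ground CHR constraint: a predicate name with a tuple of constants. -/
abbrev GroundAtom := ℕ × List Const

/-- The ground instance of a CHR constraint under a valuation. -/
def Atom.ground (w : Valuation) (a : Atom) : GroundAtom := (a.pred, a.args.map (Term.eval w))

/-- The CHR constraint in a constraint, if there is one. -/
def Constraint.atom? : Constraint → Option Atom
  | .builtin _ => none
  | .chr a => some a

/-- The equation in a constraint, if there is one. -/
def Constraint.eqn? : Constraint → Option Equation
  | .builtin e => some e
  | .chr _ => none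

/-- All head atoms of a rule, kept or removed. -/
def Rule.heads (r : Rule) : List Atom := r.keep ++ r.remove

/-- The CHR constraints in the body of a rule. -/
def Rule.bodyAtoms (r : Rule) : List Atom := r.body.filterMap Constraint.atom?

/-- The equations in the body of a rule. -/
def Rule.bodyEqs (r : Rule) : List Equation := r.body.filterMap Constraint.eqn?

/-- The CHR constraints that are there after the rule has replaced its head.  Up to identifiers, a
propagation rule removes its head and restores it at once. -/
def Rule.children (r : Rule) : List Atom := r.keep ++ r.bodyAtoms

/-- The guard of the rule holds for the ground constraint `g`, its variables taking values as in
some valuation from `V`. -/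
def Rule.Enabled (V : Set Valuation) (r : Rule) (g : GroundAtom) : Prop :=
  ∃ w ∈ V, (∀ h ∈ r.heads, h.ground w = g) ∧ w.Satisfies r.guard

/-- The valuation `w` matches the head of the rule with `g` and satisfies the equations in the
body.  The guard is not mentioned, since its equations are tested but not added to the store. -/
def Rule.Fires (r : Rule) (g : GroundAtom) (w : Valuation) : Prop :=
  (∀ h ∈ r.heads, h.ground w = g) ∧ w.Satisfies r.bodyEqs

/-- The behaviour of a plan for one CHR constraint, as a function of the values of its arguments.
Values stand for arguments up to equality in a built-in store. -/
structure Summary where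
  /-- The store may stay as it is: rules of the plan that are enabled add no further equation. -/
  rests : GroundAtom → Prop
  /-- The plan may rest although one of its rules is not enabled. -/
  stalls : GroundAtom → Prop
  /-- All rules of the plan are fired, and no rule of the program is enabled afterwards. -/
  succeeds : GroundAtom → Prop

/-- The summary of doing nothing with a constraint. -/
def leafSummary (V : Set Valuation) (P : Program) : Summary where
  rests _ := True
  stalls _ := False
  succeeds g := ∀ r ∈ P, ¬ r.Enabled V g

/-- The summary of firing a rule, if the new constraints are processed with given summaries. -/
def nodeSummary (V : Set Valuation) (r : Rule) (cs : List (Atom × Summary)) : Summary where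
  rests g := r.Enabled V g → ∃ w ∈ V, r.Fires g w ∧ ∀ p ∈ cs, p.2.rests (p.1.ground w)
  stalls g := ¬ r.Enabled V g ∨ ∃ w ∈ V, r.Fires g w ∧ (∀ p ∈ cs, p.2.rests (p.1.ground w)) ∧
    ∃ p ∈ cs, p.2.stalls (p.1.ground w)
  succeeds g := r.Enabled V g ∧ ∃ w ∈ V, r.Fires g w ∧ ∀ p ∈ cs, p.2.succeeds (p.1.ground w)

/-- A plan says what is to be done with a CHR constraint: nothing, or to fire a rule as soon as it
is enabled, and to process the `i`-th of the resulting constraints according to the plan `T i`. -/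
inductive Plan where
  | leaf
  | node (r : Rule) (T : ℕ → Plan)

/-- The plan uses only rules of the program. -/
def Plan.Valid (P : Program) : Plan → Prop
  | leaf => True
  | node r T => r ∈ P ∧ ∀ i, (T i).Valid P

/-- The number of rule applications in a plan. -/
def Plan.size : Plan → ℕ
  | leaf => 0
  | node r T => (r.children.mapIdx fun i _ => (T i).size).sum + 1

/-- The summary of a plan. -/
def Plan.summary (V : Set Valuation) (P : Program) : Plan → Summary
  | leaf => leafSummary V P
  | node r T => nodeSummary V r (r.children.mapIdx fun i a => (a, (T i).summary V P))

/-- Run in isolation, a constraint with this summary fires all rules of the plan, unless the store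
fails, and then either fails or ends with no rule enabled. -/
def Summary.Terminates (s : Summary) (g : GroundAtom) : Prop :=
  ¬ s.stalls g ∧ (s.rests g → s.succeeds g)

/-- A rule that introduces a goal. -/
def goalRule (G : Goal) : Rule := ⟨[], [], [], G⟩

/-! ### Plans for a multiset of constraints -/

/-- `τ` lists CHR constraints with plans, and `Sat` is the set of solutions of a built-in store.
All plans are completed unless the store fails, and if it does not fail, then afterwards no rule
is enabled. -/
def Completes (P : Program) (τ : Multiset (Atom × Plan)) (Sat : Valuation → Prop) : Prop :=
  (∀ v, Sat v → (∀ p ∈ τ, (p.2.summary Set.univ P).rests (p.1.ground v)) →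
    ∀ p ∈ τ, ¬ (p.2.summary Set.univ P).stalls (p.1.ground v)) ∧
  ((∃ v, Sat v ∧ ∀ p ∈ τ, (p.2.summary Set.univ P).rests (p.1.ground v)) →
    ∃ v, Sat v ∧ ∀ p ∈ τ, (p.2.summary Set.univ P).succeeds (p.1.ground v))

theorem forall_mapIdx_ground {β : Type*} (L : List Atom) (F : ℕ → β) (w : Valuation)
    (Q : β → GroundAtom → Prop) :
    (∀ p ∈ L.mapIdx (fun i a => (a, F i)), Q p.2 (p.1.ground w)) ↔
      ∀ i g, (L.map (Atom.ground w))[i]? = some g → Q (F i) g := by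
  simp only [List.mem_mapIdx, List.getElem?_map]
  constructor
  · intro h i g hg
    obtain ⟨a, ha, rfl⟩ := Option.map_eq_some_iff.1 hg
    obtain ⟨hi, rfl⟩ := List.getElem?_eq_some_iff.1 ha
    exact h _ ⟨i, hi, rfl⟩
  · rintro h _ ⟨i, hi, rfl⟩
    exact h i _ (by simp [hi])

theorem forall_mapIdx_congr {β : Type*} {L L' : List Atom} {w w' : Valuation}
    (h : L.map (Atom.ground w) = L'.map (Atom.ground w')) (F : ℕ → β)
    (Q : β → GroundAtom → Prop) :
    (∀ p ∈ L.mapIdx (fun i a => (a, F i)), Q p.2 (p.1.ground w)) ↔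
      ∀ p ∈ L'.mapIdx (fun i a => (a, F i)), Q p.2 (p.1.ground w') := by
  rw [forall_mapIdx_ground, forall_mapIdx_ground, h]

theorem Plan.summary_node (V : Set Valuation) (P : Program) (r : Rule) (T : ℕ → Plan) :
    (node r T).summary V P = nodeSummary V r
      ((r.children.mapIdx fun i a => (a, T i)).map fun p => (p.1, p.2.summary V P)) := by
  rw [summary]
  exact congrArg _ (List.ext_getElem (by simp) (by simp))

theorem Plan.rests_node (V : Set Valuation) (P : Program) (r : Rule) (T : ℕ → Plan)
    (g : GroundAtom) : ((node r T).summary V P).rests g ↔ (r.Enabled V g → ∃ w ∈ V, r.Fires g w ∧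
      ∀ p ∈ r.children.mapIdx (fun i a => (a, T i)), (p.2.summary V P).rests (p.1.ground w)) := by
  simp only [summary_node, nodeSummary, List.forall_mem_map]

theorem Plan.stalls_node (V : Set Valuation) (P : Program) (r : Rule) (T : ℕ → Plan)
    (g : GroundAtom) : ((node r T).summary V P).stalls g ↔
      (r.Enabled V g → ∃ w ∈ V, r.Fires g w ∧
        (∀ p ∈ r.children.mapIdx (fun i a => (a, T i)),
          (p.2.summary V P).rests (p.1.ground w)) ∧
        ¬ ∀ p ∈ r.children.mapIdx (fun i a => (a, T i)),
          ¬ (p.2.summary V P).stalls (p.1.ground w)) := by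
  rw [imp_iff_not_or]
  simp only [summary_node, nodeSummary, List.forall_mem_map]
  simp only [not_forall, not_not, List.mem_map, exists_prop, exists_exists_and_eq_and]

theorem Plan.succeeds_node (V : Set Valuation) (P : Program) (r : Rule) (T : ℕ → Plan)
    (g : GroundAtom) : ((node r T).summary V P).succeeds g ↔ (r.Enabled V g ∧ ∃ w ∈ V, r.Fires g w ∧
      ∀ p ∈ r.children.mapIdx (fun i a => (a, T i)),
        (p.2.summary V P).succeeds (p.1.ground w)) := by
  simp only [summary_node, nodeSummary, List.forall_mem_map]

/-- Firing an enabled rule according to a plan does not change whether the plans complete.  The new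
constraints `L` may differ from those of the rule as long as the new store identifies them. -/
theorem completes_fire {P : Program} {r : Rule} {T : ℕ → Plan} {c : Atom}
    {τ : Multiset (Atom × Plan)} {Sat Sat' : Valuation → Prop} {L : List Atom} {ρ : Var → Var}
    (henabled : ∀ v, Sat v → r.Enabled Set.univ (c.ground v))
    (hsat : ∀ v, Sat' v ↔ Sat v ∧ r.Fires (c.ground v) (v ∘ ρ))
    (hL : ∀ v, Sat' v → L.map (Atom.ground v) = r.children.map (Atom.ground (v ∘ ρ)))
    (hext : ∀ v w, Sat v → r.Fires (c.ground v) w → ∃ v', Sat' v' ∧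
      r.children.map (Atom.ground (v' ∘ ρ)) = r.children.map (Atom.ground w) ∧
      ∀ p ∈ τ, p.1.ground v' = p.1.ground v) :
    Completes P ((c, .node r T) ::ₘ τ) Sat ↔
      Completes P (↑(L.mapIdx fun i a => (a, T i)) + τ) Sat' := by
  have hadd : ∀ (l : List (Atom × Plan)) (Q : Atom × Plan → Prop),
      (∀ p ∈ ↑l + τ, Q p) ↔ (∀ p ∈ l, Q p) ∧ ∀ p ∈ τ, Q p := fun l Q => by
    simp only [Multiset.mem_add, Multiset.mem_coe, or_imp, forall_and]
  simp only [Completes, Multiset.forall_mem_cons, hadd, Plan.rests_node, Plan.stalls_node,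
    Plan.succeeds_node, Set.mem_univ, true_and]
  constructor
  · rintro ⟨h1, h2⟩
    refine ⟨fun v hv hr => ?_, ?_⟩
    · have hs := (hsat v).1 hv
      have hcong := forall_mapIdx_congr (hL v hv) T
      have hrc := (hcong fun T g => (T.summary Set.univ P).rests g).1 hr.1
      have h := h1 v hs.1 ⟨fun _ => ⟨_, hs.2, hrc⟩, hr.2⟩
      refine ⟨?_, h.2⟩
      rw [hcong fun T g => ¬ (T.summary Set.univ P).stalls g]
      by_contra hst
      exact h.1 fun _ => ⟨_, hs.2, hrc, hst⟩
    · rintro ⟨v, hv, hr⟩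
      have hs := (hsat v).1 hv
      have hcong := forall_mapIdx_congr (hL v hv) T
      have hrc := (hcong fun T g => (T.summary Set.univ P).rests g).1 hr.1
      obtain ⟨v, hv, ⟨-, w, hw, hc⟩, hτ⟩ :=
        h2 ⟨v, hs.1, fun _ => ⟨_, hs.2, hrc⟩, hr.2⟩
      obtain ⟨v', hv', hw', hτ'⟩ := hext v w hv hw
      refine ⟨v', hv', ?_, fun p hp => hτ' p hp ▸ hτ p hp⟩
      exact (forall_mapIdx_congr ((hL v' hv').trans hw') T
        fun T g => (T.summary Set.univ P).succeeds g).2 hc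
  · rintro ⟨h1, h2⟩
    refine ⟨fun v hv hr => ?_, ?_⟩
    · have he := henabled v hv
      have key : ∀ w, r.Fires (c.ground v) w →
          (∀ p ∈ r.children.mapIdx (fun i a => (a, T i)),
            (p.2.summary Set.univ P).rests (p.1.ground w)) →
          (∀ p ∈ r.children.mapIdx (fun i a => (a, T i)),
            ¬ (p.2.summary Set.univ P).stalls (p.1.ground w)) ∧
          ∀ p ∈ τ, ¬ (p.2.summary Set.univ P).stalls (p.1.ground v) := by
        intro w hw hc
        obtain ⟨v', hv', hw', hτ'⟩ := hext v w hv hw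
        have hcong := forall_mapIdx_congr ((hL v' hv').trans hw') T
        have h := h1 v' hv' ⟨(hcong fun T g => (T.summary Set.univ P).rests g).2 hc,
          fun p hp => (hτ' p hp).symm ▸ hr.2 p hp⟩
        exact ⟨(hcong fun T g => ¬ (T.summary Set.univ P).stalls g).1 h.1,
          fun p hp => hτ' p hp ▸ h.2 p hp⟩
      obtain ⟨w, hw, hc⟩ := hr.1 he
      refine ⟨fun hst => ?_, (key w hw hc).2⟩
      obtain ⟨w, hw, hc, hn⟩ := hst he
      exact hn (key w hw hc).1
    · rintro ⟨v, hv, hr⟩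
      obtain ⟨w, hw, hc⟩ := hr.1 (henabled v hv)
      obtain ⟨v', hv', hw', hτ'⟩ := hext v w hv hw
      have hcong := forall_mapIdx_congr ((hL v' hv').trans hw') T
      obtain ⟨v, hv, h⟩ := h2 ⟨v', hv', (hcong fun T g => (T.summary Set.univ P).rests g).2 hc,
          fun p hp => (hτ' p hp).symm ▸ hr.2 p hp⟩
      have hs := (hsat v).1 hv
      exact ⟨v, hs.1, ⟨henabled v hs.1, _, hs.2, (forall_mapIdx_congr (hL v hv) T
        fun T g => (T.summary Set.univ P).succeeds g).1 h.1⟩, h.2⟩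

end CHR

/-! ### Renaming and matching -/

namespace CHR

theorem Term.eval_rename (ρ : Var → Var) (v : Valuation) (t : Term) :
    (t.rename ρ).eval v = t.eval (v ∘ ρ) := by
  cases t <;> rfl

theorem Atom.ground_rename (ρ : Var → Var) (v : Valuation) (a : Atom) :
    (a.rename ρ).ground v = a.ground (v ∘ ρ) := by
  simp [ground, rename, Term.eval_rename]

theorem Valuation.satisfies_append {v : Valuation} {B C : List Equation} :
    v.Satisfies (B ++ C) ↔ v.Satisfies B ∧ v.Satisfies C := by
  simp [Satisfies, or_imp, forall_and]

theorem Valuation.satisfies_map_rename {ρ : Var → Var} {v : Valuation} {B : List Equation} :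
    v.Satisfies (B.map (Equation.rename ρ)) ↔ Satisfies (v ∘ ρ) B := by
  simp [Satisfies, Equation.rename, Term.eval_rename]

theorem Term.eval_congr {v w : Valuation} {t : Term} (h : ∀ x ∈ t.vars, v x = w x) :
    t.eval v = t.eval w := by
  cases t with
  | var x => exact h x (by simp [vars])
  | const a => rfl

theorem Atom.ground_congr {v w : Valuation} {a : Atom} (h : ∀ x ∈ a.vars, v x = w x) :
    a.ground v = a.ground w := by
  refine congrArg (Prod.mk _) (List.map_congr_left fun t ht => Term.eval_congr fun x hx => h x ?_)
  exact List.mem_flatMap.2 ⟨t, ht, hx⟩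

theorem Valuation.satisfies_congr {v w : Valuation} {B : List Equation}
    (h : ∀ e ∈ B, ∀ x ∈ e.vars, v x = w x) : v.Satisfies B ↔ w.Satisfies B := by
  refine forall₂_congr fun e he => ?_
  rw [Term.eval_congr fun x hx => h e he x (List.mem_append_left _ hx),
    Term.eval_congr fun x hx => h e he x (List.mem_append_right _ hx)]

theorem Term.vars_rename (ρ : Var → Var) (t : Term) : (t.rename ρ).vars = t.vars.map ρ := by
  cases t <;> rfl

theorem Equation.vars_rename (ρ : Var → Var) (e : Equation) :
    (e.rename ρ).vars = e.vars.map ρ := by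
  simp [vars, rename, Term.vars_rename]

theorem Atom.vars_rename (ρ : Var → Var) (a : Atom) : (a.rename ρ).vars = a.vars.map ρ := by
  simp [vars, rename, List.flatMap_map, List.map_flatMap, Term.vars_rename]

theorem Constraint.vars_rename (ρ : Var → Var) (c : Constraint) :
    (c.rename ρ).vars = c.vars.map ρ := by
  cases c
  · exact Equation.vars_rename ρ _
  · exact Atom.vars_rename ρ _

theorem Rule.vars_rename (ρ : Var → Var) (r : Rule) : (r.rename ρ).vars = r.vars.map ρ := by
  simp [vars, rename, List.flatMap_map, List.map_flatMap, Atom.vars_rename,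
    Equation.vars_rename, Constraint.vars_rename]

theorem Constraint.atom?_rename (ρ : Var → Var) (c : Constraint) :
    (c.rename ρ).atom? = c.atom?.map (Atom.rename ρ) := by
  cases c <;> rfl

theorem Constraint.eqn?_rename (ρ : Var → Var) (c : Constraint) :
    (c.rename ρ).eqn? = c.eqn?.map (Equation.rename ρ) := by
  cases c <;> rfl

theorem Rule.bodyAtoms_rename (ρ : Var → Var) (r : Rule) :
    (r.rename ρ).bodyAtoms = r.bodyAtoms.map (Atom.rename ρ) := by
  simp only [bodyAtoms, rename, List.filterMap_map, List.map_filterMap]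
  exact List.filterMap_congr fun c _ => Constraint.atom?_rename ρ c

theorem Rule.bodyEqs_rename (ρ : Var → Var) (r : Rule) :
    (r.rename ρ).bodyEqs = r.bodyEqs.map (Equation.rename ρ) := by
  simp only [bodyEqs, rename, List.filterMap_map, List.map_filterMap]
  exact List.filterMap_congr fun c _ => Constraint.eqn?_rename ρ c

theorem Constraint.atom?_eq_some {c : Constraint} {a : Atom} : c.atom? = some a ↔ c = .chr a := by
  cases c <;> simp [atom?]

theorem Constraint.eqn?_eq_some {c : Constraint} {e : Equation} :
    c.eqn? = some e ↔ c = .builtin e := by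
  cases c <;> simp [eqn?]

theorem Rule.vars_of_mem_heads {r : Rule} {h : Atom} (hh : h ∈ r.heads) {x : Var}
    (hx : x ∈ h.vars) : x ∈ r.vars := by
  simp only [vars, List.mem_append, List.mem_flatMap]
  rcases List.mem_append.1 hh with hh | hh
  · exact .inl (.inl (.inl ⟨h, hh, hx⟩))
  · exact .inl (.inl (.inr ⟨h, hh, hx⟩))

theorem Rule.vars_of_mem_guard {r : Rule} {e : Equation} (he : e ∈ r.guard) {x : Var}
    (hx : x ∈ e.vars) : x ∈ r.vars := by
  simp only [vars, List.mem_append, List.mem_flatMap]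
  exact .inl (.inr ⟨e, he, hx⟩)

theorem Rule.vars_of_mem_bodyEqs {r : Rule} {e : Equation} (he : e ∈ r.bodyEqs) {x : Var}
    (hx : x ∈ e.vars) : x ∈ r.vars := by
  obtain ⟨c, hc, hce⟩ := List.mem_filterMap.1 he
  rw [Constraint.eqn?_eq_some] at hce
  subst hce
  simp only [vars, List.mem_append, List.mem_flatMap]
  exact .inr ⟨_, hc, hx⟩

theorem Rule.vars_of_mem_children {r : Rule} {a : Atom} (ha : a ∈ r.children) {x : Var}
    (hx : x ∈ a.vars) : x ∈ r.vars := by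
  rcases List.mem_append.1 ha with ha | ha
  · exact vars_of_mem_heads (List.mem_append_left _ ha) hx
  · obtain ⟨c, hc, hca⟩ := List.mem_filterMap.1 ha
    rw [Constraint.atom?_eq_some] at hca
    subst hca
    simp only [vars, List.mem_append, List.mem_flatMap]
    exact .inr ⟨_, hc, hx⟩

theorem Rule.fires_congr {r : Rule} {g : GroundAtom} {v w : Valuation}
    (h : ∀ x ∈ r.vars, v x = w x) : r.Fires g v ↔ r.Fires g w := by
  refine and_congr (forall₂_congr fun a ha => ?_) (Valuation.satisfies_congr fun e he x hx =>
    h x (vars_of_mem_bodyEqs he hx))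
  rw [Atom.ground_congr fun x hx => h x (vars_of_mem_heads ha hx)]

/-- A valuation of the variables of a configuration and one of the variables of a rule are combined
after renaming the rule apart. -/
theorem exists_glue {ρ : Var → Var} (hρ : Function.Injective ρ) (ys : List Var)
    (v w : Valuation) : ∃ v' : Valuation, (∀ x ∉ ys.map ρ, v' x = v x) ∧
      ∀ x ∈ ys, v' (ρ x) = w x := by
  refine ⟨fun x => if x ∈ ys.map ρ then w (Function.invFun ρ x) else v x, fun x hx => if_neg hx,
    fun x hx => ?_⟩
  beta_reduce
  rw [if_pos (List.mem_map_of_mem hx), Function.leftInverse_invFun hρ]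

theorem satisfies_argEqs {v : Valuation} {h c : Atom} (hl : h.args.length = c.args.length) :
    v.Satisfies (h.argEqs c) ↔ h.args.map (Term.eval v) = c.args.map (Term.eval v) := by
  obtain ⟨p, as⟩ := h
  obtain ⟨q, bs⟩ := c
  simp only [Atom.argEqs] at *
  induction as generalizing bs with
  | nil => cases bs <;> simp_all [Valuation.Satisfies]
  | cons a as ih =>
    cases bs with
    | nil => simp at hl
    | cons b bs =>
      have := ih bs (by simpa using hl)
      simp_all [Valuation.Satisfies]

theorem satisfies_matchEqs {v : Valuation} {ρ : Var → Var} {c : Atom} {hs cs : List Atom}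
    (hc : ∀ c' ∈ cs, c' = c) (hp : List.Forall₂ Atom.SamePred (hs.map (Atom.rename ρ)) cs) :
    v.Satisfies (matchEqs (hs.map (Atom.rename ρ)) cs) ↔
      ∀ h ∈ hs, h.ground (v ∘ ρ) = c.ground v := by
  induction hs generalizing cs with
  | nil => simp [matchEqs, Valuation.Satisfies]
  | cons h hs ih =>
    rw [List.map_cons, List.forall₂_cons_left_iff] at hp
    obtain ⟨c', cs, hp, hps, rfl⟩ := hp
    obtain rfl : c' = c := hc c' (by simp)
    have ih := ih (fun c hc' => hc c (by simp [hc'])) hps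
    have h1 : h.ground (v ∘ ρ) = c'.ground v ↔ v.Satisfies ((h.rename ρ).argEqs c') := by
      rw [satisfies_argEqs hp.2, ← Atom.ground_rename]
      exact Prod.ext_iff.trans (and_iff_right hp.1)
    rw [List.forall_mem_cons, ← ih, h1, ← Valuation.satisfies_append]
    rfl

/-! ### The transitions and the plans -/

/-- The CHR constraints of a configuration. -/
def Config.atoms (s : Config) : Multiset Atom :=
  s.goal.filterMap Constraint.atom? + s.store.map Prod.fst

/-- The valuation satisfies all equations of the configuration. -/
def Config.Sat (s : Config) (v : Valuation) : Prop :=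
  v.Satisfies s.builtins ∧ ∀ e, Constraint.builtin e ∈ s.goal → e.lhs.eval v = e.rhs.eval v

theorem Config.sat_congr {s : Config} {v w : Valuation} (h : ∀ x, s.HasVar x → v x = w x) :
    s.Sat v ↔ s.Sat w := by
  refine and_congr (Valuation.satisfies_congr fun e he x hx => h x (.inr (.inr ⟨e, he, hx⟩)))
    (forall₂_congr fun e he => ?_)
  rw [Term.eval_congr fun x hx => h x (.inl ⟨_, he, List.mem_append_left _ hx⟩),
    Term.eval_congr fun x hx => h x (.inl ⟨_, he, List.mem_append_right _ hx⟩)]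

theorem Config.hasVar_of_mem_atoms {s : Config} {a : Atom} (ha : a ∈ s.atoms) {x : Var}
    (hx : x ∈ a.vars) : s.HasVar x := by
  rcases Multiset.mem_add.1 ha with ha | ha
  · obtain ⟨c, hc, hca⟩ := (Multiset.mem_filterMap _ _).1 ha
    rw [Constraint.atom?_eq_some] at hca
    subst hca
    exact .inl ⟨_, hc, hx⟩
  · obtain ⟨p, hp, rfl⟩ := Multiset.mem_map.1 ha
    exact .inr (.inl ⟨p, hp, hx⟩)

/-- The constraints produced when the rule, renamed by `ρ`, is applied to `c`.  A head that is kept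
is represented by `c` itself. -/
def Rule.instances (r : Rule) (c : Atom) (ρ : Var → Var) : List Atom :=
  (r.keep.map fun _ => c) ++ r.bodyAtoms.map (Atom.rename ρ)

theorem Rule.instances_ground {r : Rule} {c : Atom} {ρ : Var → Var} {v : Valuation}
    (h : r.Fires (c.ground v) (v ∘ ρ)) :
    (r.instances c ρ).map (Atom.ground v) = r.children.map (Atom.ground (v ∘ ρ)) := by
  simp only [instances, children, List.map_append, List.map_map]
  congr 1
  · exact List.map_congr_left fun a ha => (h.1 a (List.mem_append_left _ ha)).symm
  · exact List.map_congr_left fun a _ => Atom.ground_rename ρ v a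

/-- The entailment that permits a rule application says that the rule is enabled in all solutions
of the store. -/
theorem entailsExists_iff {r : Rule} {ρ : Var → Var} (hρ : Function.Injective ρ) {c : Atom}
    {K R : List Atom} (hc : ∀ c' ∈ K ++ R, c' = c) {B : List Equation}
    (hcv : ∀ x ∈ (r.rename ρ).vars, x ∉ c.vars)
    (hK : List.Forall₂ Atom.SamePred (r.rename ρ).keep K)
    (hR : List.Forall₂ Atom.SamePred (r.rename ρ).remove R) :
    EntailsExists B (r.rename ρ).vars (matchEqs (r.rename ρ).keep K ++
      matchEqs (r.rename ρ).remove R ++ (r.rename ρ).guard) ↔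
      ∀ v : Valuation, v.Satisfies B → r.Enabled Set.univ (c.ground v) := by
  refine forall₂_congr fun v _ => ?_
  have key : ∀ w : Valuation, w.Satisfies (matchEqs (r.rename ρ).keep K ++
      matchEqs (r.rename ρ).remove R ++ (r.rename ρ).guard) ↔
      (∀ h ∈ r.heads, h.ground (w ∘ ρ) = c.ground w) ∧ Valuation.Satisfies (w ∘ ρ) r.guard := by
    intro w
    rw [Valuation.satisfies_append, Valuation.satisfies_append]
    refine and_congr ?_ Valuation.satisfies_map_rename
    refine (and_congr (satisfies_matchEqs (fun a ha => hc a (List.mem_append_left _ ha)) hK)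
      (satisfies_matchEqs (fun a ha => hc a (List.mem_append_right _ ha)) hR)).trans ?_
    simp only [Rule.heads, List.mem_append, or_imp, forall_and]
  have hcg : ∀ w : Valuation, (∀ x, x ∉ (r.rename ρ).vars → w x = v x) →
      c.ground w = c.ground v := fun w hw =>
    Atom.ground_congr fun x hx => hw x fun hx' => hcv x hx' hx
  constructor
  · rintro ⟨w, hw, hs⟩
    rw [key, hcg w hw] at hs
    exact ⟨w ∘ ρ, trivial, hs⟩
  · rintro ⟨w, -, h1, h2⟩
    obtain ⟨v', hv', hw⟩ := exists_glue hρ r.vars v w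
    rw [← Rule.vars_rename] at hv'
    refine ⟨v', hv', (key v').2 ⟨fun h hh => ?_, ?_⟩⟩
    · rw [hcg v' hv', ← h1 h hh]
      exact Atom.ground_congr fun x hx => hw x (Rule.vars_of_mem_heads hh hx)
    · exact (Valuation.satisfies_congr fun e he x hx =>
        hw x (Rule.vars_of_mem_guard he hx)).2 h2

/-- An application of a rule to one constraint `c` follows every plan that tells to apply that rule
to `c`. -/
theorem completes_apply (P : Program) {r : Rule} {ρ : Var → Var} (hρ : Function.Injective ρ)
    {c : Atom} {i : ℕ} {K R : List IdAtom} (hKR : K ++ R = [(c, i)]) {G : Multiset Constraint}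
    {S : Multiset IdAtom} {B : List Equation} {n : ℕ} {s s' : Config}
    (hs : s = ⟨G, ↑K + ↑R + S, B, n⟩)
    (hs' : s' = ⟨↑(r.rename ρ).body + G, ↑K + S,
      matchEqs (r.rename ρ).keep (K.map Prod.fst) ++
        matchEqs (r.rename ρ).remove (R.map Prod.fst) ++ B, n⟩)
    (apart : ∀ x ∈ (r.rename ρ).vars, ¬ s.HasVar x)
    (hK : List.Forall₂ Atom.SamePred (r.rename ρ).keep (K.map Prod.fst))
    (hR : List.Forall₂ Atom.SamePred (r.rename ρ).remove (R.map Prod.fst))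
    (henabled : ∀ v : Valuation, v.Satisfies B → r.Enabled Set.univ (c.ground v)) :
    ∃ A : Multiset Atom, s.atoms = c ::ₘ A ∧ s'.atoms = ↑(r.instances c ρ) + A ∧
      ∀ T (τ : Multiset (Atom × Plan)), τ.map Prod.fst = A →
        (Completes P ((c, .node r T) ::ₘ τ) s.Sat ↔
          Completes P (↑((r.instances c ρ).mapIdx fun i a => (a, T i)) + τ) s'.Sat) := by
  have hc : ∀ c' ∈ K.map Prod.fst ++ R.map Prod.fst, c' = c := by
    rw [← List.map_append, hKR]
    simp
  have hatoms : s.atoms = c ::ₘ (G.filterMap Constraint.atom? + S.map Prod.fst) := by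
    have : (↑K + ↑R : Multiset IdAtom) = {(c, i)} := by
      rw [Multiset.coe_add, hKR]
      rfl
    rw [hs, Config.atoms]
    simp only [this, Multiset.singleton_add, Multiset.map_cons, Multiset.add_cons]
  have hKl : K.map Prod.fst = r.keep.map fun _ => c := by
    have hl : K.length = r.keep.length := by
      simpa [Rule.rename] using hK.length_eq.symm
    rw [List.map_const', List.eq_replicate_iff]
    exact ⟨by simpa using hl, fun a ha => hc a (List.mem_append_left _ ha)⟩
  refine ⟨_, hatoms, ?_, fun T τ hτ => ?_⟩
  · rw [hs', Config.atoms]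
    simp only [Multiset.map_add, Multiset.filterMap_add, Multiset.map_coe, hKl,
      Multiset.filterMap_coe, Rule.instances, ← Multiset.coe_add, ← Rule.bodyAtoms_rename]
    rw [Rule.bodyAtoms]
    abel
  · have hsat : ∀ v, s'.Sat v ↔ s.Sat v ∧ r.Fires (c.ground v) (v ∘ ρ) := by
      intro v
      have h1 := satisfies_matchEqs (v := v) (fun a ha => hc a (List.mem_append_left _ ha)) hK
      have h2 := satisfies_matchEqs (v := v) (fun a ha => hc a (List.mem_append_right _ ha)) hR
      have h3 : Valuation.Satisfies (v ∘ ρ) r.bodyEqs ↔ ∀ e,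
          Constraint.builtin e ∈ (r.rename ρ).body → e.lhs.eval v = e.rhs.eval v := by
        rw [← Valuation.satisfies_map_rename, ← Rule.bodyEqs_rename]
        simp only [Valuation.Satisfies, Rule.bodyEqs, List.mem_filterMap,
          Constraint.eqn?_eq_some, exists_eq_right]
      rw [hs, hs', Config.Sat, Config.Sat, Rule.Fires, h3, Valuation.satisfies_append,
        Valuation.satisfies_append]
      have h1' : v.Satisfies (matchEqs (r.rename ρ).keep (K.map Prod.fst)) ↔ _ := h1
      have h2' : v.Satisfies (matchEqs (r.rename ρ).remove (R.map Prod.fst)) ↔ _ := h2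
      simp only [h1', h2', Multiset.mem_add, Multiset.mem_coe, or_imp, forall_and, Rule.heads,
        List.mem_append]
      tauto
    have hB : ∀ v, s.Sat v → v.Satisfies B := fun v hv => by
      rw [hs] at hv
      exact hv.1
    refine completes_fire (ρ := ρ) (fun v hv => henabled v (hB v hv)) hsat
      (fun v hv => Rule.instances_ground ((hsat v).1 hv).2) fun v w hv hw => ?_
    obtain ⟨v', hv', hw'⟩ := exists_glue hρ r.vars v w
    rw [← Rule.vars_rename] at hv'
    have hagree : ∀ x, s.HasVar x → v' x = v x := fun x hx => hv' x fun hx' => apart x hx' hx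
    have hground : ∀ a ∈ s.atoms, a.ground v' = a.ground v := fun a ha =>
      Atom.ground_congr fun x hx => hagree x (Config.hasVar_of_mem_atoms ha hx)
    refine ⟨v', (hsat v').2 ⟨(Config.sat_congr hagree).2 hv, ?_⟩, ?_, fun p hp => ?_⟩
    · rw [hground c (by simp [hatoms])]
      exact (Rule.fires_congr hw').2 hw
    · exact List.map_congr_left fun a ha =>
        Atom.ground_congr fun x hx => hw' x (Rule.vars_of_mem_children ha hx)
    · refine hground _ ?_
      rw [hatoms, ← hτ]
      exact Multiset.mem_cons_of_mem (Multiset.mem_map_of_mem _ hp)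

end CHR

/-! ### Bounds on names, and generic solutions of a store -/

namespace CHR

open Filter

/-- The name of the variable or constant is less than `N`. -/
def Term.Bdd (N : ℕ) : Term → Prop
  | .var x => x < N
  | .const a => a < N

/-- All names in the equation are less than `N`. -/
def Equation.Bdd (N : ℕ) (e : Equation) : Prop := e.lhs.Bdd N ∧ e.rhs.Bdd N

/-- All names in the constraint, and its arity, are less than `N`. -/
def Atom.Bdd (N : ℕ) (a : Atom) : Prop := a.pred < N ∧ a.args.length < N ∧ ∀ t ∈ a.args, t.Bdd N

/-- All names and arities in the rule are less than `N`. -/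
def Rule.Bdd (N : ℕ) (r : Rule) : Prop :=
  (∀ a ∈ r.heads, a.Bdd N) ∧ (∀ e ∈ r.guard, e.Bdd N) ∧ (∀ e ∈ r.bodyEqs, e.Bdd N) ∧
    ∀ a ∈ r.bodyAtoms, a.Bdd N

theorem eventually_forall_mem {α : Type*} {p : ℕ → α → Prop} (l : List α)
    (h : ∀ a, ∀ᶠ N in atTop, p N a) : ∀ᶠ N in atTop, ∀ a ∈ l, p N a :=
  (eventually_all_finite (List.finite_toSet l)).2 fun a _ => h a

theorem Term.eventually_bdd (t : Term) : ∀ᶠ N in atTop, t.Bdd N := by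
  cases t <;> exact eventually_gt_atTop _

theorem Equation.eventually_bdd (e : Equation) : ∀ᶠ N in atTop, e.Bdd N :=
  e.lhs.eventually_bdd.and e.rhs.eventually_bdd

theorem Atom.eventually_bdd (a : Atom) : ∀ᶠ N in atTop, a.Bdd N :=
  (eventually_gt_atTop _).and
    ((eventually_gt_atTop _).and (eventually_forall_mem _ Term.eventually_bdd))

theorem Rule.eventually_bdd (r : Rule) : ∀ᶠ N in atTop, r.Bdd N :=
  (eventually_forall_mem _ Atom.eventually_bdd).and
    ((eventually_forall_mem _ Equation.eventually_bdd).and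
      ((eventually_forall_mem _ Equation.eventually_bdd).and
        (eventually_forall_mem _ Atom.eventually_bdd)))

theorem Rule.Bdd.children {N : ℕ} {r : Rule} (h : r.Bdd N) {a : Atom} (ha : a ∈ r.children) :
    a.Bdd N := by
  rcases List.mem_append.1 ha with ha | ha
  · exact h.1 a (List.mem_append_left _ ha)
  · exact h.2.2.2 a ha

/-- Replacing the constants in a ground constraint. -/
def GroundAtom.map (φ : Const → Const) (g : GroundAtom) : GroundAtom := (g.1, g.2.map φ)

theorem Term.eval_comp {N : ℕ} {φ : Const → Const} (hφ : ∀ a < N, φ a = a) {t : Term}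
    (ht : t.Bdd N) (w : Valuation) : t.eval (φ ∘ w) = φ (t.eval w) := by
  cases t with
  | var x => rfl
  | const a => exact (hφ a ht).symm

theorem Atom.ground_comp {N : ℕ} {φ : Const → Const} (hφ : ∀ a < N, φ a = a) {a : Atom}
    (ha : a.Bdd N) (w : Valuation) : a.ground (φ ∘ w) = GroundAtom.map φ (a.ground w) := by
  refine congrArg (Prod.mk _) ?_
  change _ = List.map φ (List.map _ a.args)
  rw [List.map_map]
  exact List.map_congr_left fun t ht => Term.eval_comp hφ (ha.2.2 t ht) w

theorem Valuation.Satisfies.comp {N : ℕ} {φ : Const → Const} (hφ : ∀ a < N, φ a = a)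
    {B : List Equation} (hB : ∀ e ∈ B, e.Bdd N) {w : Valuation} (h : w.Satisfies B) :
    Satisfies (φ ∘ w) B := by
  intro e he
  rw [Term.eval_comp hφ (hB e he).1, Term.eval_comp hφ (hB e he).2, h e he]

/-- Enabledness is preserved when constants that do not occur in the rule are replaced. -/
theorem Rule.Enabled.map {N : ℕ} {φ : Const → Const} (hφ : ∀ a < N, φ a = a) {r : Rule}
    (hr : r.Bdd N) {g : GroundAtom} (h : r.Enabled Set.univ g) :
    r.Enabled Set.univ (GroundAtom.map φ g) := by
  obtain ⟨w, -, h1, h2⟩ := h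
  refine ⟨φ ∘ w, trivial, fun a ha => ?_, h2.comp hφ hr.2.1⟩
  rw [Atom.ground_comp hφ (hr.1 a ha), h1 a ha]

/-- A consistent store has a most general solution `v`: all other solutions arise from it by
replacing constants that do not occur in the store.  This is where it matters that there are
infinitely many constants. -/
theorem exists_generic {B : List Equation} {N : ℕ} (hB : ∀ e ∈ B, e.Bdd N)
    (hc : ¬ Inconsistent B) : ∃ v : Valuation, v.Satisfies B ∧
      ∀ v' : Valuation, v'.Satisfies B → ∃ φ : Const → Const, (∀ a < N, φ a = a) ∧ v' = φ ∘ v := by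
  classical
  obtain ⟨v₀, hv₀⟩ : ∃ v₀ : Valuation, v₀.Satisfies B := by
    simpa [Inconsistent] using hc
  -- The generic value of an expression `F` is the constant below `N` that it is forced to have, if
  -- there is one, and otherwise a new constant, named after the first variable equal to `F`.
  let forced : (Valuation → Const) → Set Const := fun F =>
    {a | a < N ∧ ∀ v : Valuation, v.Satisfies B → F v = a}
  let val : (Valuation → Const) → Const := fun F =>
    if (forced F).Nonempty then sInf (forced F)
    else N + sInf {y | ∀ v : Valuation, v.Satisfies B → v y = F v}
  have val_congr : ∀ F F' : Valuation → Const,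
      (∀ v : Valuation, v.Satisfies B → F v = F' v) → val F = val F' := by
    intro F F' h
    have h1 : forced F = forced F' := by
      ext a
      exact and_congr_right fun _ => forall₂_congr fun v hv => by rw [h v hv]
    have h2 : {y | ∀ v : Valuation, v.Satisfies B → v y = F v} =
        {y | ∀ v : Valuation, v.Satisfies B → v y = F' v} := by
      ext y
      exact forall₂_congr fun v hv => by rw [h v hv]
    simp only [val, h1, h2]
  have val_spec : ∀ x, ∀ v' : Valuation, v'.Satisfies B →
      v' x = if val (fun v => v x) < N then val (fun v => v x)
        else v' (val (fun v => v x) - N) := by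
    intro x v' hv'
    by_cases hf : (forced fun v => v x).Nonempty
    · have := Nat.sInf_mem hf
      simp only [val, if_pos hf, if_pos this.1]
      exact this.2 v' hv'
    · have hne : {y | ∀ v : Valuation, v.Satisfies B → v y = v x}.Nonempty := ⟨x, fun _ _ => rfl⟩
      simp only [val, if_neg hf, Nat.not_lt.2 (Nat.le_add_right _ _), if_false,
        Nat.add_sub_cancel_left]
      exact (Nat.sInf_mem hne v' hv').symm
  refine ⟨fun x => val fun v => v x, fun e he => ?_, fun v' hv' => ?_⟩
  · have heval : ∀ t : Term, t.Bdd N →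
        t.eval (fun x => val fun v => v x) = val fun v => t.eval v := by
      intro t ht
      cases t with
      | var x => rfl
      | const a =>
        have hf : forced (fun _ => a) = {a} := by
          ext b
          refine ⟨fun hb => (hb.2 v₀ hv₀).symm, fun hb => ?_⟩
          obtain rfl : b = a := hb
          exact ⟨ht, fun _ _ => rfl⟩
        change a = val fun _ => a
        simp only [val, hf, Set.singleton_nonempty, if_true, csInf_singleton]
    rw [heval _ (hB e he).1, heval _ (hB e he).2]
    exact val_congr _ _ fun v hv => hv e he
  · exact ⟨fun a => if a < N then a else v' (a - N), fun a ha => if_pos ha,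
      funext fun x => val_spec x v' hv'⟩

/-- At a most general solution of a consistent store, a rule is enabled only if it is enabled at
every solution, that is, only if the store entails its applicability. -/
theorem exists_generic_enabled (P : Program) {B : List Equation} (A : List Atom)
    (hc : ¬ Inconsistent B) : ∃ v : Valuation, v.Satisfies B ∧ ∀ r ∈ P, ∀ c ∈ A,
      r.Enabled Set.univ (c.ground v) →
        ∀ v' : Valuation, v'.Satisfies B → r.Enabled Set.univ (c.ground v') := by
  obtain ⟨N, hP, hB, hA⟩ := ((eventually_forall_mem P Rule.eventually_bdd).and
    ((eventually_forall_mem B Equation.eventually_bdd).and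
      (eventually_forall_mem A Atom.eventually_bdd))).exists
  obtain ⟨v, hv, hgen⟩ := exists_generic hB hc
  refine ⟨v, hv, fun r hr c hcA he v' hv' => ?_⟩
  obtain ⟨φ, hφ, rfl⟩ := hgen v' hv'
  rw [Atom.ground_comp hφ (hA c hcA)]
  exact he.map hφ (hP r hr)

/-! ### Terminating computations and plans -/

theorem Config.exists_var_bound (s : Config) : ∃ M, ∀ x, s.HasVar x → x < M := by
  have hl : ∀ l : List Var, ∀ᶠ M in atTop, ∀ x ∈ l, x < M := fun l =>
    eventually_forall_mem l fun x => eventually_gt_atTop x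
  obtain ⟨M, h1, h2, h3⟩ := ((eventually_forall_mem s.goal.toList fun c => hl c.vars).and
    ((eventually_forall_mem s.store.toList fun c => hl c.1.vars).and
      (eventually_forall_mem s.builtins fun e => hl e.vars))).exists
  refine ⟨M, ?_⟩
  rintro x (⟨c, hc, hx⟩ | ⟨c, hc, hx⟩ | ⟨e, he, hx⟩)
  · exact h1 c (Multiset.mem_toList.2 hc) x hx
  · exact h2 c (Multiset.mem_toList.2 hc) x hx
  · exact h3 e he x hx

/-- A rule that is enabled for a stored constraint in all solutions can be applied, and its
application follows every plan that tells to do so. -/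
theorem exists_apply {P : Program} (hP : P.IsSingleHeaded) {r : Rule} (hr : r ∈ P) {s : Config}
    {c : Atom} {i : ℕ} (hc : (c, i) ∈ s.store) (hcons : ¬ Inconsistent s.builtins)
    (he : ∀ v : Valuation, v.Satisfies s.builtins → r.Enabled Set.univ (c.ground v)) :
    ∃ (s' : Config) (ρ : Var → Var) (A : Multiset Atom), Step P s s' ∧ s.atoms = c ::ₘ A ∧
      s'.atoms = ↑(r.instances c ρ) + A ∧
      ∀ T (τ : Multiset (Atom × Plan)), τ.map Prod.fst = A →
        (Completes P ((c, .node r T) ::ₘ τ) s.Sat ↔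
          Completes P (↑((r.instances c ρ).mapIdx fun i a => (a, T i)) + τ) s'.Sat) := by
  obtain ⟨M, hM⟩ := s.exists_var_bound
  obtain ⟨v, hv⟩ : ∃ v : Valuation, v.Satisfies s.builtins := by
    simpa [Inconsistent] using hcons
  obtain ⟨w, -, hw, -⟩ := he v hv
  let ρ : Var → Var := fun x => x + M
  have hρ : Function.Injective ρ := fun x y h => Nat.add_right_cancel h
  have apart : ∀ x ∈ (r.rename ρ).vars, ¬ s.HasVar x := by
    intro x hx hs
    rw [Rule.vars_rename] at hx
    obtain ⟨y, -, rfl⟩ := List.mem_map.1 hx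
    exact absurd (hM _ hs) (by simp [ρ])
  have hsame : ∀ h ∈ r.heads, Atom.SamePred (h.rename ρ) c := by
    intro h hh
    have := Prod.ext_iff.1 (hw h hh)
    refine ⟨this.1, ?_⟩
    have := congrArg List.length this.2
    simpa [Atom.ground, Atom.rename] using this
  obtain ⟨K, R, hKR, hK, hR⟩ : ∃ K R : List IdAtom, K ++ R = [(c, i)] ∧
      List.Forall₂ Atom.SamePred (r.rename ρ).keep (K.map Prod.fst) ∧
      List.Forall₂ Atom.SamePred (r.rename ρ).remove (R.map Prod.fst) := by
    obtain ⟨h, hh⟩ := List.length_eq_one_iff.1 (hP r hr)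
    have hs := hsame h (by rw [Rule.heads, hh]; simp)
    rcases List.append_eq_singleton_iff.1 hh with ⟨h1, h2⟩ | ⟨h1, h2⟩
    · exact ⟨[], [(c, i)], rfl, by simp [Rule.rename, h1], by simpa [Rule.rename, h2] using hs⟩
    · exact ⟨[(c, i)], [], rfl, by simpa [Rule.rename, h1] using hs, by simp [Rule.rename, h2]⟩
  obtain ⟨S, hS⟩ := Multiset.exists_cons_of_mem hc
  have hs : s = ⟨s.goal, ↑K + ↑R + S, s.builtins, s.next⟩ := by
    rw [Multiset.coe_add, hKR]
    cases s
    simpa using hS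
  obtain ⟨A, hA, hA', h⟩ := completes_apply P hρ hKR hs rfl apart hK hR he
  refine ⟨_, ρ, A, ?_, hA, hA', h⟩
  rw [hs] at apart
  have hstep := Step.apply (P := P) r ρ K R s.goal S s.builtins s.next hr hρ apart hK hR ?_
  · rwa [← hs] at hstep
  · refine (entailsExists_iff hρ (c := c) ?_ ?_ hK hR).2 he
    · rw [← List.map_append, hKR]
      simp
    · intro x hx hxc
      rw [← hs] at apart
      exact apart x hx (.inr (.inl ⟨_, hc, hxc⟩))

/-- A single-headed rule that is applied matches one constraint, for which it is enabled. -/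
theorem enabled_of_apply {r : Rule} (hr : r.IsSingleHeaded) {ρ : Var → Var}
    (hρ : Function.Injective ρ) {K R : List IdAtom} {G : Multiset Constraint}
    {S : Multiset IdAtom} {B : List Equation} {n : ℕ}
    (apart : ∀ x ∈ (r.rename ρ).vars, ¬ Config.HasVar ⟨G, ↑K + ↑R + S, B, n⟩ x)
    (hK : List.Forall₂ Atom.SamePred (r.rename ρ).keep (K.map Prod.fst))
    (hR : List.Forall₂ Atom.SamePred (r.rename ρ).remove (R.map Prod.fst))
    (he : EntailsExists B (r.rename ρ).vars (matchEqs (r.rename ρ).keep (K.map Prod.fst) ++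
      matchEqs (r.rename ρ).remove (R.map Prod.fst) ++ (r.rename ρ).guard)) :
    ∃ c i, K ++ R = [(c, i)] ∧
      ∀ v : Valuation, v.Satisfies B → r.Enabled Set.univ (c.ground v) := by
  have hlen : (K ++ R).length = 1 := by
    have h1 := hK.length_eq
    have h2 := hR.length_eq
    have h3 : (r.keep ++ r.remove).length = 1 := hr
    simp only [Rule.rename, List.length_map, List.length_append] at h1 h2 h3 ⊢
    omega
  obtain ⟨⟨c, i⟩, hKR⟩ := List.length_eq_one_iff.1 hlen
  exact ⟨c, i, hKR, (entailsExists_iff hρ (c := c) (by rw [← List.map_append, hKR]; simp)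
    (fun x hx hxc => apart x hx (.inr (.inl ⟨(c, i), by simp [hKR], hxc⟩))) hK hR).1 he⟩

/-- There are plans for the constraints of a configuration such that all are completed unless the
store fails, and that lead to a terminating computation. -/
def Promising (P : Program) (s : Config) : Prop :=
  ∃ τ : Multiset (Atom × Plan), τ.map Prod.fst = s.atoms ∧ (∀ p ∈ τ, p.2.Valid P) ∧
    Completes P τ s.Sat

theorem Config.atoms_solve (e : Equation) (G : Multiset Constraint) (S : Multiset IdAtom)
    (B : List Equation) (n : ℕ) :
    Config.atoms ⟨.builtin e ::ₘ G, S, B, n⟩ = Config.atoms ⟨G, S, e :: B, n⟩ :=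
  congrArg (· + S.map Prod.fst) (Multiset.filterMap_cons_none (Constraint.builtin e) G rfl)

theorem Config.sat_solve (e : Equation) (G : Multiset Constraint) (S : Multiset IdAtom)
    (B : List Equation) (n : ℕ) :
    Config.Sat ⟨.builtin e ::ₘ G, S, B, n⟩ = Config.Sat ⟨G, S, e :: B, n⟩ := by
  funext v
  simp only [Sat, Valuation.Satisfies, Multiset.mem_cons, List.mem_cons, Constraint.builtin.injEq,
    or_imp, forall_and, forall_eq]
  exact propext (by tauto)

theorem Config.atoms_introduce (a : Atom) (G : Multiset Constraint) (S : Multiset IdAtom)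
    (B : List Equation) (n : ℕ) :
    Config.atoms ⟨.chr a ::ₘ G, S, B, n⟩ = Config.atoms ⟨G, (a, n) ::ₘ S, B, n + 1⟩ := by
  simp [Config.atoms, Constraint.atom?]

theorem Config.sat_introduce (a : Atom) (G : Multiset Constraint) (S : Multiset IdAtom)
    (B : List Equation) (n : ℕ) :
    Config.Sat ⟨.chr a ::ₘ G, S, B, n⟩ = Config.Sat ⟨G, (a, n) ::ₘ S, B, n + 1⟩ := by
  funext v
  simp [Sat]

open scoped Classical in
/-- Constraints paired with plans can be separated along the constraints that a step has added. -/
theorem exists_split {α β : Type*} (f : α → β) {τ : Multiset α} {L : List β} {A : Multiset β}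
    (h : τ.map f = ↑L + A) :
    ∃ (l : List α) (τ' : Multiset α), τ = ↑l + τ' ∧ l.map f = L ∧ τ'.map f = A := by
  induction L generalizing τ with
  | nil => exact ⟨[], τ, by simp, rfl, by simpa using h⟩
  | cons b L ih =>
    rw [← Multiset.cons_coe, Multiset.cons_add] at h
    obtain ⟨a, ha, hab, h⟩ := (Multiset.map_eq_cons f τ _ b).2 h
    obtain ⟨l, τ', hl, rfl, rfl⟩ := ih h
    refine ⟨a :: l, τ', ?_, by rw [List.map_cons, hab], rfl⟩
    rw [← Multiset.cons_coe, Multiset.cons_add, ← hl, Multiset.cons_erase ha]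

/-- The plans of the instances of a rule body are the subtrees of a single node. -/
theorem exists_mapIdx_eq {P : Program} (l : List (Atom × Plan))
    (hval : ∀ p ∈ (l : Multiset (Atom × Plan)), p.2.Valid P) {L : List Atom}
    (hl : l.map Prod.fst = L) : ∃ T : ℕ → Plan, (∀ i, (T i).Valid P) ∧
      L.mapIdx (fun i a => (a, T i)) = l := by
  refine ⟨fun i => (l[i]?.map Prod.snd).getD .leaf, fun i => ?_, ?_⟩
  · by_cases hi : i < l.length
    · simpa [hi] using hval l[i] (by simp)
    · simp [hi, Plan.Valid]
  · rw [← hl]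
    exact List.ext_getElem (by simp) fun i h1 h2 => by simp [h2]

/-- Plans for the successor of a step give plans for the configuration before it: when a rule is
applied, the plans of its body become the subtrees of a new node. -/
theorem Promising.of_step {P : Program} (hP : P.IsSingleHeaded) {s s' : Config}
    (h : Step P s s') (hs : Promising P s') : Promising P s := by
  obtain ⟨τ, hτ, hval, hcomp⟩ := hs
  cases h with
  | solve e G S B n =>
    exact ⟨τ, hτ.trans (Config.atoms_solve ..).symm, hval, (Config.sat_solve e G S B n) ▸ hcomp⟩
  | introduce a G S B n =>
    exact ⟨τ, hτ.trans (Config.atoms_introduce ..).symm, hval,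
      (Config.sat_introduce a G S B n) ▸ hcomp⟩
  | apply r ρ K R G S B n hr hρ apart hK hR he =>
    obtain ⟨c, i, hKR, hce⟩ := enabled_of_apply (hP r hr) hρ apart hK hR he
    obtain ⟨A, hA, hA', h⟩ := completes_apply P hρ hKR rfl rfl apart hK hR hce
    obtain ⟨l, τ', rfl, hl, hτ'⟩ := exists_split _ (hτ.trans hA')
    obtain ⟨T, hTval, hT⟩ :=
      exists_mapIdx_eq l (fun p hp => hval p (Multiset.mem_add.2 (.inl hp))) hl
    refine ⟨(c, .node r T) ::ₘ τ', by rw [Multiset.map_cons, hτ', hA], ?_,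
      (h T τ' hτ').2 (hT.symm ▸ hcomp)⟩
    rw [Multiset.forall_mem_cons]
    exact ⟨⟨hr, hTval⟩, fun p hp => hval p (Multiset.mem_add.2 (.inr hp))⟩

/-- In a final configuration, the plan to do nothing at all completes. -/
theorem Promising.of_isFinal {P : Program} (hP : P.IsSingleHeaded) {s : Config}
    (h : s.IsFinal P) : Promising P s := by
  refine ⟨s.atoms.map fun a => (a, .leaf), by simp, by simp [Plan.Valid], ?_, ?_⟩
  · simp [Plan.summary, leafSummary]
  · rintro ⟨v, hv, -⟩
    have hcons : ¬ Inconsistent s.builtins := fun hi => hi v hv.1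
    obtain ⟨hgoal, hstep⟩ := h.resolve_left hcons
    obtain ⟨v, hv, hgen⟩ := exists_generic_enabled P s.atoms.toList hcons
    refine ⟨v, ⟨hv, by simp [hgoal]⟩, ?_⟩
    simp only [Multiset.mem_map, forall_exists_index, and_imp, forall_apply_eq_imp_iff₂,
      Plan.summary, leafSummary]
    intro c hc r hr he
    have hall := hgen r hr c (Multiset.mem_toList.2 hc) he
    obtain ⟨⟨c, i⟩, hci, rfl⟩ : ∃ p ∈ s.store, p.1 = c := by
      simpa [Config.atoms, hgoal] using hc
    obtain ⟨s', -, -, hs', -⟩ := exists_apply hP hr hci hcons hall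
    exact hstep s' hs'

/-- Following plans that complete gives a terminating computation. -/
theorem Promising.exists_isFinal {P : Program} (hP : P.IsSingleHeaded) {s : Config}
    (h : Promising P s) : ∃ s', Relation.ReflTransGen (Step P) s s' ∧ s'.IsFinal P := by
  obtain ⟨τ, hτ, hval, hcomp⟩ := h
  -- The number of pending rule applications decreases, or else the goal gets smaller.
  induction hm : (τ.map fun p => p.2.size).sum using Nat.strong_induction_on
    generalizing s τ with
  | _ m ihm =>
  induction hk : Multiset.card s.goal generalizing s with
  | succ k ihk =>
    obtain ⟨G', S, B, n⟩ := s
    obtain ⟨x, hx⟩ := Multiset.card_pos_iff_exists_mem.1 (Nat.lt_of_lt_of_eq k.succ_pos hk.symm)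
    obtain ⟨G, hG⟩ := Multiset.exists_cons_of_mem hx
    obtain rfl : G' = x ::ₘ G := hG
    have hk' : Multiset.card G = k := by simpa using hk
    cases x with
    | builtin e =>
      rw [Config.atoms_solve] at hτ
      rw [Config.sat_solve] at hcomp
      obtain ⟨s', h1, h2⟩ := ihk hτ hcomp hk'
      exact ⟨s', .head (.solve ..) h1, h2⟩
    | chr a =>
      rw [Config.atoms_introduce] at hτ
      rw [Config.sat_introduce] at hcomp
      obtain ⟨s', h1, h2⟩ := ihk hτ hcomp hk'
      exact ⟨s', .head (.introduce ..) h1, h2⟩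
  | zero =>
    have hgoal : s.goal = 0 := Multiset.card_eq_zero.1 hk
    by_cases hcons : Inconsistent s.builtins
    · exact ⟨s, .refl, .inl hcons⟩
    have hstore : ∀ p ∈ τ, ∃ i, (p.1, i) ∈ s.store := by
      intro p hp
      have := hτ ▸ Multiset.mem_map_of_mem Prod.fst hp
      simpa [Config.atoms, hgoal] using this
    obtain ⟨v, hv, hgen⟩ := exists_generic_enabled P s.atoms.toList hcons
    by_cases hex : ∃ c r T, (c, Plan.node r T) ∈ τ ∧ r.Enabled Set.univ (c.ground v)
    · obtain ⟨c, r, T, hp, he⟩ := hex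
      have hr := hval _ hp
      obtain ⟨i, hci⟩ := hstore _ hp
      have hca : c ∈ s.atoms := hτ ▸ Multiset.mem_map_of_mem Prod.fst hp
      obtain ⟨s₁, ρ, A, hstep, hA, hA', h⟩ := exists_apply hP hr.1 hci hcons
        (hgen r hr.1 c (Multiset.mem_toList.2 hca) he)
      obtain ⟨τ', rfl⟩ := Multiset.exists_cons_of_mem hp
      rw [hA, Multiset.map_cons, Multiset.cons_inj_right] at hτ
      have hlen : (r.instances c ρ).length = r.children.length := by
        simp [Rule.instances, Rule.children]
      have hsize : ((r.instances c ρ).mapIdx fun i _ => (T i).size) =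
          r.children.mapIdx fun i _ => (T i).size :=
        List.ext_getElem (by simp [hlen]) (by simp)
      have hlt : ((↑((r.instances c ρ).mapIdx fun i a => (a, T i)) + τ').map
          fun p => p.2.size).sum < m := by
        have : ((r.instances c ρ).mapIdx fun i a => (a, T i)).map (fun p => p.2.size) =
            r.children.mapIdx fun i _ => (T i).size := by
          rw [← hsize]
          exact List.ext_getElem (by simp) (by simp)
        rw [← hm]
        simp only [Multiset.map_add, Multiset.map_coe, this, Multiset.sum_add, Multiset.sum_coe,
          Multiset.map_cons, Multiset.sum_cons, Plan.size]
        omega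
      have hfst : (↑((r.instances c ρ).mapIdx fun i a => (a, T i)) + τ').map Prod.fst =
          s₁.atoms := by
        rw [Multiset.map_add, hτ, hA', Multiset.map_coe]
        congr 2
        exact List.ext_getElem (by simp) (by simp)
      have hval' : ∀ p ∈ (↑((r.instances c ρ).mapIdx fun i a => (a, T i)) + τ'), p.2.Valid P := by
        intro p hp
        rcases Multiset.mem_add.1 hp with hp | hp
        · obtain ⟨i, hi, rfl⟩ := List.mem_mapIdx.1 hp
          exact hr.2 i
        · exact hval p (Multiset.mem_cons_of_mem hp)
      obtain ⟨s', h1, h2⟩ := ihm _ hlt _ hfst hval' ((h T τ' hτ).1 hcomp) rfl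
      exact ⟨s', .head hstep h1, h2⟩
    · -- No rule of the plans is enabled, so the store rests, and all plans have been completed.
      push Not at hex
      have hsat : s.Sat v := ⟨hv, by simp [hgoal]⟩
      have hrest : ∀ p ∈ τ, (p.2.summary Set.univ P).rests (p.1.ground v) := by
        rintro ⟨c, _ | ⟨r, T⟩⟩ hp
        · trivial
        · exact fun he => absurd he (hex c r T hp)
      have hleaf : ∀ p ∈ τ, p.2 = .leaf := by
        rintro ⟨c, _ | ⟨r, T⟩⟩ hp
        · rfl
        · exact absurd (.inl (hex c r T hp)) (hcomp.1 v hsat hrest _ hp)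
      obtain ⟨v, hv, hsucc⟩ := hcomp.2 ⟨v, hsat, hrest⟩
      refine ⟨s, .refl, .inr ⟨hgoal, fun s' hstep => ?_⟩⟩
      clear ihm
      cases hstep with
      | solve => simp at hgoal
      | introduce => simp at hgoal
      | apply r ρ K R G S B n hr hρ apart hK hR he =>
        obtain ⟨c, i, hKR, hce⟩ := enabled_of_apply (hP r hr) hρ apart hK hR he
        have hc : c ∈ τ.map Prod.fst := by
          rw [hτ]
          simp [Config.atoms, hKR]
        obtain ⟨p, hp, rfl⟩ := Multiset.mem_map.1 hc
        have := hsucc p hp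
        rw [hleaf p hp] at this
        exact this r hr (hce v hv.1)

/-- For a single-headed program, a goal has a terminating computation if and only if it has a plan
whose summary shows that it terminates. -/
theorem hasTerminatingComputation_iff {P : Program} (hP : P.IsSingleHeaded) (G : Goal) :
    HasTerminatingComputation P G ↔ ∃ T : ℕ → Plan, (∀ i, (T i).Valid P) ∧
      ((Plan.node (goalRule G) T).summary Set.univ P).Terminates (0, []) := by
  have hatoms : (initial G).atoms = ↑(goalRule G).children := by
    simp [Config.atoms, initial, Rule.children, Rule.bodyAtoms, goalRule]
  have hSat : ∀ v, (initial G).Sat v ↔ (goalRule G).Fires (0, []) v := fun v => by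
    simp [Config.Sat, initial, Rule.Fires, Rule.heads, Rule.bodyEqs, goalRule,
      Valuation.Satisfies, Constraint.eqn?_eq_some]
  have henabled : (goalRule G).Enabled Set.univ (0, []) :=
    ⟨0, trivial, by simp [goalRule, Rule.heads], by simp [goalRule, Valuation.Satisfies]⟩
  have hterm : ∀ T : ℕ → Plan, ((Plan.node (goalRule G) T).summary Set.univ P).Terminates (0, []) ↔
      Completes P ↑((goalRule G).children.mapIdx fun i a => (a, T i)) (initial G).Sat := by
    intro T
    rw [Summary.Terminates, Plan.rests_node, Plan.stalls_node, Plan.succeeds_node, Completes]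
    simp only [henabled, hSat, true_imp_iff, true_and, Set.mem_univ, Multiset.mem_coe]
    refine and_congr ?_ Iff.rfl
    simp only [not_exists, not_and, not_not]
  have hprom : HasTerminatingComputation P G ↔ Promising P (initial G) := by
    constructor
    · rintro ⟨s, hs, hf⟩
      generalize initial G = s₀ at hs
      induction hs using Relation.ReflTransGen.head_induction_on with
      | refl => exact .of_isFinal hP hf
      | head h _ ih => exact ih.of_step hP h
    · exact fun h => h.exists_isFinal hP
  rw [hprom]
  constructor
  · rintro ⟨τ, hτ, hval, hcomp⟩
    obtain ⟨l, τ', rfl, hl, hτ'⟩ := exists_split Prod.fst (A := 0)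
      (hτ.trans (hatoms.trans (add_zero _).symm))
    obtain rfl := Multiset.map_eq_zero.1 hτ'
    rw [add_zero] at hcomp hval
    obtain ⟨T, hT, hT'⟩ := exists_mapIdx_eq l hval hl
    exact ⟨T, hT, (hterm T).2 (hT'.symm ▸ hcomp)⟩
  · rintro ⟨T, hT, h⟩
    refine ⟨_, ?_, ?_, (hterm T).1 h⟩
    · rw [hatoms, Multiset.map_coe]
      exact congrArg _ (List.ext_getElem (by simp) (by simp))
    · intro p hp
      obtain ⟨i, hi, rfl⟩ := List.mem_mapIdx.1 hp
      exact hT i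

end CHR

/-! ### Summaries over a finite universe -/

namespace CHR

open Filter

/-- A summary that does not distinguish ground constraints which differ by the permutation `π` of
the constants. -/
def Summary.Invariant (π : Equiv.Perm Const) (s : Summary) : Prop :=
  ∀ g, (s.rests (GroundAtom.map π g) ↔ s.rests g) ∧ (s.stalls (GroundAtom.map π g) ↔ s.stalls g) ∧
    (s.succeeds (GroundAtom.map π g) ↔ s.succeeds g)

/-- Two summaries that agree on a set of ground constraints. -/
def Summary.AgreeOn (A : Set GroundAtom) (s s' : Summary) : Prop :=
  ∀ g ∈ A, (s.rests g ↔ s'.rests g) ∧ (s.stalls g ↔ s'.stalls g) ∧ (s.succeeds g ↔ s'.succeeds g)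

theorem Summary.AgreeOn.trans {A : Set GroundAtom} {s₁ s₂ s₃ : Summary} (h : s₁.AgreeOn A s₂)
    (h' : s₂.AgreeOn A s₃) : s₁.AgreeOn A s₃ := fun g hg =>
  ⟨(h g hg).1.trans (h' g hg).1, (h g hg).2.1.trans (h' g hg).2.1,
    (h g hg).2.2.trans (h' g hg).2.2⟩

theorem Summary.AgreeOn.symm {A : Set GroundAtom} {s₁ s₂ : Summary} (h : s₁.AgreeOn A s₂) :
    s₂.AgreeOn A s₁ := fun g hg => ⟨(h g hg).1.symm, (h g hg).2.1.symm, (h g hg).2.2.symm⟩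

theorem Summary.AgreeOn.terminates_iff {A : Set GroundAtom} {s₁ s₂ : Summary}
    (h : s₁.AgreeOn A s₂) {g : GroundAtom} (hg : g ∈ A) : s₁.Terminates g ↔ s₂.Terminates g := by
  rw [Terminates, Terminates, (h g hg).1, (h g hg).2.1, (h g hg).2.2]

theorem GroundAtom.map_symm_map (π : Equiv.Perm Const) (g : GroundAtom) :
    GroundAtom.map π.symm (GroundAtom.map π g) = g := by
  simp [GroundAtom.map]

theorem GroundAtom.map_injective (π : Equiv.Perm Const) :
    Function.Injective (GroundAtom.map π) :=
  Function.LeftInverse.injective (map_symm_map π)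

theorem symm_fixes {N : ℕ} {π : Equiv.Perm Const} (hπ : ∀ a < N, π a = a) :
    ∀ a < N, π.symm a = a := fun a ha => by
  rw [Equiv.symm_apply_eq, hπ a ha]

theorem Rule.enabled_map_iff {N : ℕ} {π : Equiv.Perm Const} (hπ : ∀ a < N, π a = a) {r : Rule}
    (hr : r.Bdd N) (g : GroundAtom) :
    r.Enabled Set.univ (GroundAtom.map π g) ↔ r.Enabled Set.univ g := by
  refine ⟨fun h => ?_, fun h => h.map hπ hr⟩
  rw [← GroundAtom.map_symm_map π g]
  exact h.map (symm_fixes hπ) hr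

theorem Rule.fires_map_iff {N : ℕ} {π : Equiv.Perm Const} (hπ : ∀ a < N, π a = a) {r : Rule}
    (hr : r.Bdd N) (g : GroundAtom) (w : Valuation) :
    r.Fires (GroundAtom.map π g) (π ∘ w) ↔ r.Fires g w := by
  refine and_congr (forall₂_congr fun h hh => ?_) (forall₂_congr fun e he => ?_)
  · rw [Atom.ground_comp hπ (hr.1 h hh), (GroundAtom.map_injective π).eq_iff]
  · rw [Term.eval_comp hπ (hr.2.2.1 e he).1, Term.eval_comp hπ (hr.2.2.1 e he).2,
      π.injective.eq_iff]

theorem leafSummary_invariant {N : ℕ} {π : Equiv.Perm Const} (hπ : ∀ a < N, π a = a) {P : Program}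
    (hP : ∀ r ∈ P, r.Bdd N) : (leafSummary Set.univ P).Invariant π := fun g =>
  ⟨Iff.rfl, Iff.rfl, forall₂_congr fun r hr => not_congr (Rule.enabled_map_iff hπ (hP r hr) g)⟩

theorem nodeSummary_invariant {N : ℕ} {π : Equiv.Perm Const} (hπ : ∀ a < N, π a = a) {r : Rule}
    (hr : r.Bdd N) {cs : List (Atom × Summary)} (hb : ∀ p ∈ cs, p.1.Bdd N)
    (hcs : ∀ p ∈ cs, p.2.Invariant π) : (nodeSummary Set.univ r cs).Invariant π := by
  have hsurj : Function.Surjective fun w : Valuation => (π ∘ w : Valuation) := fun w =>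
    ⟨π.symm ∘ w, funext fun x => π.apply_symm_apply _⟩
  intro g
  simp only [nodeSummary, Rule.enabled_map_iff hπ hr, Set.mem_univ, true_and]
  refine ⟨imp_congr_right fun _ => ?_, or_congr_right ?_, and_congr_right fun _ => ?_⟩
  all_goals
    refine hsurj.exists.trans (exists_congr fun w => and_congr (Rule.fires_map_iff hπ hr g w) ?_)
  · refine forall₂_congr fun p hp => ?_
    rw [Atom.ground_comp hπ (hb p hp), (hcs p hp _).1]
  · refine and_congr (forall₂_congr fun p hp => ?_) (exists_congr fun p =>
      and_congr_right fun hp => ?_)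
    · rw [Atom.ground_comp hπ (hb p hp), (hcs p hp _).1]
    · rw [Atom.ground_comp hπ (hb p hp), (hcs p hp _).2.1]
  · refine forall₂_congr fun p hp => ?_
    rw [Atom.ground_comp hπ (hb p hp), (hcs p hp _).2.2]

theorem Plan.summary_invariant {N : ℕ} {π : Equiv.Perm Const} (hπ : ∀ a < N, π a = a)
    {P : Program} (hP : ∀ r ∈ P, r.Bdd N) {T : Plan} (hT : T.Valid P) :
    (T.summary Set.univ P).Invariant π := by
  induction T with
  | leaf => exact leafSummary_invariant hπ hP
  | node r T ih =>
    refine nodeSummary_invariant hπ (hP r hT.1) ?_ ?_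
    · simp only [List.mem_mapIdx]
      rintro _ ⟨i, hi, rfl⟩
      exact (hP r hT.1).children (List.getElem_mem hi)
    · simp only [List.mem_mapIdx]
      rintro _ ⟨i, hi, rfl⟩
      exact ih i (hT.2 i)

/-- The valuations of the variables below `N` by constants below `2 * N`.  The constants below `N`
may occur in the program, and the others suffice to give all variables different values. -/
def finiteValuations (N : ℕ) : Set Valuation := {w | (∀ x < N, w x < 2 * N) ∧ ∀ x, N ≤ x → w x = 0}

/-- The ground constraints that arise from bounded constraints by these valuations. -/
def finiteAtoms (N : ℕ) : Set GroundAtom :=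
  {g | g.1 < N ∧ g.2.length < N ∧ ∀ a ∈ g.2, a < 2 * N}

/-- Used to move the large values of a valuation into the finite universe without disturbing the
small ones. -/
theorem exists_perm_mapsTo (X Y : Finset ℕ) (hd : Disjoint X Y) (hc : X.card ≤ Y.card) :
    ∃ π : Equiv.Perm ℕ, (∀ x ∈ X, π x ∈ Y) ∧ ∀ z, z ∉ X → z ∉ Y → π z = z := by
  induction X using Finset.induction_on generalizing Y with
  | empty => exact ⟨1, by simp, by simp⟩
  | insert x X hx ih =>
    rw [Finset.card_insert_of_notMem hx] at hc
    rw [Finset.disjoint_insert_left] at hd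
    obtain ⟨y, hy⟩ := Finset.card_pos.1 (Nat.lt_of_lt_of_le X.card.succ_pos hc)
    obtain ⟨π, h1, h2⟩ := ih (Y.erase y) (hd.2.mono_right (Finset.erase_subset _ _))
      (by rw [Finset.card_erase_of_mem hy]; omega)
    have hyX : y ∉ X := fun h => Finset.disjoint_left.1 hd.2 h hy
    have hxy : x ≠ y := fun h => hd.1 (h ▸ hy)
    refine ⟨π * Equiv.swap x y, fun z hz => ?_, fun z hz hzY => ?_⟩
    · rcases Finset.mem_insert.1 hz with rfl | hz
      · rw [Equiv.Perm.mul_apply, Equiv.swap_apply_left, h2 y hyX (Finset.notMem_erase _ _)]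
        exact hy
      · rw [Equiv.Perm.mul_apply, Equiv.swap_apply_of_ne_of_ne (ne_of_mem_of_not_mem hz hx)
          (ne_of_mem_of_not_mem hz hyX)]
        exact Finset.mem_of_mem_erase (h1 z hz)
    · rw [Finset.mem_insert, not_or] at hz
      rw [Equiv.Perm.mul_apply, Equiv.swap_apply_of_ne_of_ne hz.1
          (ne_of_mem_of_not_mem hy hzY).symm,
        h2 z hz.2 fun h => hzY (Finset.mem_of_mem_erase h)]

/-- The values of the variables below `N` can be moved into the finite universe. -/
theorem exists_finiteValuation (N : ℕ) (w : Valuation) :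
    ∃ π : Equiv.Perm Const, (∀ a < N, π a = a) ∧ ∃ w' ∈ finiteValuations N,
      (∀ x < N, w' x = (π ∘ w : Valuation) x) ∧ ∀ x < N, w x < 2 * N → w' x = w x := by
  classical
  let W : Finset ℕ := (Finset.range N).image w
  let I : Finset ℕ := Finset.Ico N (2 * N)
  let X := W.filter fun a => 2 * N ≤ a
  have hcard : X.card ≤ (I \ W).card := by
    have h1 : W.card ≤ N := Finset.card_image_le.trans (by simp)
    have h2 : I.card = N := by simp only [I, Nat.card_Ico]; omega
    have h3 : (I \ W).card + (I ∩ W).card = I.card := Finset.card_sdiff_add_card_inter _ _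
    have h4 : Disjoint X (I ∩ W) := by
      rw [Finset.disjoint_left]
      intro a ha hb
      have := (Finset.mem_filter.1 ha).2
      have := (Finset.mem_Ico.1 (Finset.mem_inter.1 hb).1).2
      omega
    have h5 : (X ∪ (I ∩ W)).card ≤ W.card := Finset.card_le_card
      (Finset.union_subset (Finset.filter_subset _ _) Finset.inter_subset_right)
    rw [Finset.card_union_of_disjoint h4] at h5
    omega
  have hdisj : Disjoint X (I \ W) := by
    rw [Finset.disjoint_left]
    intro a ha hb
    exact (Finset.mem_sdiff.1 hb).2 (Finset.mem_filter.1 ha).1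
  obtain ⟨π, h1, h2⟩ := exists_perm_mapsTo X (I \ W) hdisj hcard
  have hX : ∀ a ∈ X, 2 * N ≤ a := fun a ha => (Finset.mem_filter.1 ha).2
  have hY : ∀ a ∈ I \ W, N ≤ a ∧ a < 2 * N := fun a ha =>
    Finset.mem_Ico.1 (Finset.mem_sdiff.1 ha).1
  have hfix : ∀ x < N, w x < 2 * N → π (w x) = w x := by
    intro x hx hwx
    refine h2 _ (fun h => absurd (hX _ h) (Nat.not_le.2 hwx)) fun h => ?_
    exact (Finset.mem_sdiff.1 h).2 (Finset.mem_image_of_mem w (Finset.mem_range.2 hx))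
  refine ⟨π, fun a ha => h2 a (fun h => absurd (hX a h) (by omega))
    fun h => absurd (hY a h) (by omega), fun x => if x < N then π (w x) else 0,
    ⟨fun x hx => ?_, fun x hx => if_neg (Nat.not_lt.2 hx)⟩, fun x hx => if_pos hx,
    fun x hx hwx => (if_pos hx).trans (hfix x hx hwx)⟩
  beta_reduce
  rw [if_pos hx]
  by_cases hwx : w x < 2 * N
  · rwa [hfix x hx hwx]
  · refine (hY _ (h1 _ (Finset.mem_filter.2 ⟨?_, Nat.not_lt.1 hwx⟩))).2
    exact Finset.mem_image_of_mem w (Finset.mem_range.2 hx)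

theorem Term.eval_congr_bdd {N : ℕ} {v w : Valuation} (h : ∀ x < N, v x = w x) {t : Term}
    (ht : t.Bdd N) : t.eval v = t.eval w := by
  cases t with
  | var x => exact h x ht
  | const a => rfl

theorem Atom.ground_congr_bdd {N : ℕ} {v w : Valuation} (h : ∀ x < N, v x = w x) {a : Atom}
    (ha : a.Bdd N) : a.ground v = a.ground w :=
  congrArg (Prod.mk _) (List.map_congr_left fun t ht => Term.eval_congr_bdd h (ha.2.2 t ht))

theorem Valuation.satisfies_congr_bdd {N : ℕ} {v w : Valuation} (h : ∀ x < N, v x = w x)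
    {B : List Equation} (hB : ∀ e ∈ B, e.Bdd N) : v.Satisfies B ↔ w.Satisfies B := by
  refine forall₂_congr fun e he => ?_
  rw [Term.eval_congr_bdd h (hB e he).1, Term.eval_congr_bdd h (hB e he).2]

theorem Atom.ground_mem_finiteAtoms {N : ℕ} {a : Atom} (ha : a.Bdd N) {w : Valuation}
    (hw : w ∈ finiteValuations N) : a.ground w ∈ finiteAtoms N := by
  refine ⟨ha.1, by simpa [ground] using ha.2.1, fun b hb => ?_⟩
  obtain ⟨t, ht, rfl⟩ := List.mem_map.1 hb
  have := ha.2.2 t ht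
  cases t with
  | var x => exact hw.1 x this
  | const a =>
    change a < 2 * N
    exact Nat.lt_of_lt_of_le this (Nat.le_mul_of_pos_left N two_pos)

/-- Every valuation can be replaced by one in the finite universe, up to a permutation of the
constants that keeps a given match of the head. -/
theorem exists_finiteValuation_rule {N : ℕ} {r : Rule} (hr : r.Bdd N) {g : GroundAtom}
    (hg : g ∈ finiteAtoms N) {w : Valuation} (hw : ∀ h ∈ r.heads, h.ground w = g) :
    ∃ π : Equiv.Perm Const, (∀ a < N, π a = a) ∧ ∃ w' ∈ finiteValuations N,
      (∀ h ∈ r.heads, h.ground w' = g) ∧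
      (∀ B : List Equation, (∀ e ∈ B, e.Bdd N) → w.Satisfies B → w'.Satisfies B) ∧
      ∀ a : Atom, a.Bdd N → a.ground w' = GroundAtom.map π (a.ground w) := by
  obtain ⟨π, hπ, w', hw', h1, h2⟩ := exists_finiteValuation N w
  refine ⟨π, hπ, w', hw', fun h hh => ?_, fun B hB hs => ?_, fun a ha => ?_⟩
  · rw [← hw h hh]
    refine congrArg (Prod.mk _) (List.map_congr_left fun t ht => ?_)
    have hlt : t.eval w < 2 * N := by
      refine hg.2.2 _ ?_
      rw [← hw h hh]
      exact List.mem_map_of_mem ht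
    have htb := (hr.1 h hh).2.2 t ht
    cases t with
    | var x => exact h2 x htb hlt
    | const a => rfl
  · exact (Valuation.satisfies_congr_bdd h1 hB).2 (hs.comp hπ hB)
  · rw [Atom.ground_congr_bdd h1 ha, Atom.ground_comp hπ ha]

theorem Rule.enabled_finite_iff {N : ℕ} {r : Rule} (hr : r.Bdd N) {g : GroundAtom}
    (hg : g ∈ finiteAtoms N) : r.Enabled Set.univ g ↔ r.Enabled (finiteValuations N) g := by
  constructor
  · rintro ⟨w, -, h1, h2⟩
    obtain ⟨-, -, w', hw', h3, h4, -⟩ := exists_finiteValuation_rule hr hg h1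
    exact ⟨w', hw', h3, h4 _ hr.2.1 h2⟩
  · rintro ⟨w, -, h⟩
    exact ⟨w, trivial, h⟩

/-- The infinite universe may be replaced by the finite one: the rule has at most `N` variables, so
that a permutation which fixes the constants below `N`, and the values that are below `2 * N`
already, moves all values below `2 * N`. The summaries of the subtrees are invariant under it. -/
theorem nodeSummary_agreeOn_finite {N : ℕ} {r : Rule} (hr : r.Bdd N) {ι : Type*}
    {l : List (Atom × ι)} (hl : ∀ p ∈ l, p.1.Bdd N) {F F' : ι → Summary}
    (hinv : ∀ π : Equiv.Perm Const, (∀ a < N, π a = a) → ∀ p ∈ l, (F p.2).Invariant π)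
    (hagree : ∀ p ∈ l, (F p.2).AgreeOn (finiteAtoms N) (F' p.2)) :
    (nodeSummary Set.univ r (l.map fun p => (p.1, F p.2))).AgreeOn (finiteAtoms N)
      (nodeSummary (finiteValuations N) r (l.map fun p => (p.1, F' p.2))) := by
  intro g hg
  have key : ∀ Q Q' : Valuation → Prop, (∀ w ∈ finiteValuations N, Q w ↔ Q' w) →
      (∀ (π : Equiv.Perm Const) (w w' : Valuation), (∀ a < N, π a = a) →
        (∀ a : Atom, a.Bdd N → a.ground w' = GroundAtom.map π (a.ground w)) → Q w → Q w') →
      ((∃ w, r.Fires g w ∧ Q w) ↔ ∃ w ∈ finiteValuations N, r.Fires g w ∧ Q' w) := by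
    intro Q Q' hQ hπQ
    constructor
    · rintro ⟨w, h1, h2⟩
      obtain ⟨π, hπ, w', hw', h3, h4, h5⟩ := exists_finiteValuation_rule hr hg h1.1
      exact ⟨w', hw', ⟨h3, h4 _ hr.2.2.1 h1.2⟩, (hQ w' hw').1 (hπQ π w w' hπ h5 h2)⟩
    · rintro ⟨w, hw, h1, h2⟩
      exact ⟨w, h1, (hQ w hw).2 h2⟩
  have hground : ∀ w ∈ finiteValuations N, ∀ p ∈ l, p.1.ground w ∈ finiteAtoms N :=
    fun w hw p hp => Atom.ground_mem_finiteAtoms (hl p hp) hw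
  simp only [nodeSummary, Rule.enabled_finite_iff hr hg, Set.mem_univ, true_and,
    List.forall_mem_map]
  simp only [List.mem_map, exists_exists_and_eq_and]
  refine ⟨imp_congr_right fun _ => key _ _ ?_ ?_, or_congr_right (key _ _ ?_ ?_),
    and_congr_right fun _ => key _ _ ?_ ?_⟩
  · exact fun w hw => forall₂_congr fun p hp => (hagree p hp _ (hground w hw p hp)).1
  · intro π w w' hπ h5 h p hp
    rw [h5 _ (hl p hp), (hinv π hπ p hp _).1]
    exact h p hp
  · exact fun w hw => and_congr
      (forall₂_congr fun p hp => (hagree p hp _ (hground w hw p hp)).1)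
      (exists_congr fun p => and_congr_right fun hp => (hagree p hp _ (hground w hw p hp)).2.1)
  · rintro π w w' hπ h5 ⟨h, p, hp, h'⟩
    refine ⟨fun p hp => ?_, p, hp, ?_⟩
    · rw [h5 _ (hl p hp), (hinv π hπ p hp _).1]
      exact h p hp
    · rwa [h5 _ (hl p hp), (hinv π hπ p hp _).2.1]
  · exact fun w hw => forall₂_congr fun p hp => (hagree p hp _ (hground w hw p hp)).2.2
  · intro π w w' hπ h5 h p hp
    rw [h5 _ (hl p hp), (hinv π hπ p hp _).2.2]
    exact h p hp

theorem Plan.summary_node_agreeOn_finite {N : ℕ} {P : Program} (hP : ∀ r ∈ P, r.Bdd N) {r : Rule}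
    (hr : r.Bdd N) {T : ℕ → Plan} (hT : ∀ i, (T i).Valid P)
    (h : ∀ i, ((T i).summary Set.univ P).AgreeOn (finiteAtoms N)
      ((T i).summary (finiteValuations N) P)) :
    ((node r T).summary Set.univ P).AgreeOn (finiteAtoms N)
      ((node r T).summary (finiteValuations N) P) := by
  rw [summary_node, summary_node]
  refine nodeSummary_agreeOn_finite hr ?_ ?_ ?_
  all_goals simp only [List.mem_mapIdx]
  · rintro _ ⟨i, hi, rfl⟩
    exact hr.children (List.getElem_mem hi)
  · rintro π hπ _ ⟨i, hi, rfl⟩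
    exact summary_invariant hπ hP (hT i)
  · rintro _ ⟨i, hi, rfl⟩
    exact h i

/-- On bounded ground constraints, the summary of a plan can be computed in the finite universe. -/
theorem Plan.summary_agreeOn_finite {N : ℕ} {P : Program} (hP : ∀ r ∈ P, r.Bdd N) {T : Plan}
    (hT : T.Valid P) : (T.summary Set.univ P).AgreeOn (finiteAtoms N)
      (T.summary (finiteValuations N) P) := by
  induction T with
  | leaf => exact fun g hg => ⟨Iff.rfl, Iff.rfl, forall₂_congr fun r hr =>
      not_congr (Rule.enabled_finite_iff (hP r hr) hg)⟩
  | node r T ih => exact summary_node_agreeOn_finite hP (hP r hT.1) hT.2 fun i => ih i (hT.2 i)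

/-- In the finite universe, the summary of a rule application depends only on the values of the
other summaries on bounded ground constraints. -/
theorem nodeSummary_congr {N : ℕ} (r : Rule) {ι : Type*} {l : List (Atom × ι)}
    (hl : ∀ p ∈ l, p.1.Bdd N) {F F' : ι → Summary}
    (hagree : ∀ p ∈ l, (F p.2).AgreeOn (finiteAtoms N) (F' p.2)) (A : Set GroundAtom) :
    (nodeSummary (finiteValuations N) r (l.map fun p => (p.1, F p.2))).AgreeOn A
      (nodeSummary (finiteValuations N) r (l.map fun p => (p.1, F' p.2))) := by
  intro g _
  have hground : ∀ w ∈ finiteValuations N, ∀ p ∈ l, p.1.ground w ∈ finiteAtoms N :=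
    fun w hw p hp => Atom.ground_mem_finiteAtoms (hl p hp) hw
  simp only [nodeSummary, List.forall_mem_map]
  simp only [List.mem_map, exists_exists_and_eq_and]
  have h1 : ∀ w ∈ finiteValuations N, (∀ p ∈ l, (F p.2).rests (p.1.ground w)) ↔
      ∀ p ∈ l, (F' p.2).rests (p.1.ground w) := fun w hw =>
    forall₂_congr fun p hp => (hagree p hp _ (hground w hw p hp)).1
  refine ⟨imp_congr_right fun _ => exists_congr fun w => and_congr_right fun hw =>
    and_congr_right fun _ => h1 w hw,
    or_congr_right (exists_congr fun w => and_congr_right fun hw => and_congr_right fun _ =>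
      and_congr (h1 w hw) ?_),
    and_congr_right fun _ => exists_congr fun w => and_congr_right fun hw =>
      and_congr_right fun _ => ?_⟩
  · exact exists_congr fun p => and_congr_right fun hp => (hagree p hp _ (hground w hw p hp)).2.1
  · exact forall₂_congr fun p hp => (hagree p hp _ (hground w hw p hp)).2.2

end CHR

/-! ### Certificates of non-termination -/

namespace CHR

open Filter

/-- A finite description of a summary: the list of the ground constraints at which it rests
(tagged `0`), stalls (tagged `1`) and succeeds (tagged `2`). -/
abbrev SummaryCode := List (ℕ × GroundAtom)

/-- The summary with a given code. -/
def SummaryCode.toSummary (c : SummaryCode) : Summary where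
  rests g := (0, g) ∈ c
  stalls g := (1, g) ∈ c
  succeeds g := (2, g) ∈ c

/-- The lists of length `n` of numbers below `m`. -/
def boundedLists (m n : ℕ) : List (List ℕ) := ((List.range n).map fun _ => List.range m).sections

/-- The ground constraints in `finiteAtoms N`. -/
def finiteAtomList (N : ℕ) : List GroundAtom :=
  (List.range N).flatMap fun p => (List.range N).flatMap fun n =>
    (boundedLists (2 * N) n).map fun l => (p, l)

/-- All ways to choose a code from `C` for each of the given constraints. -/
def assignments (as : List Atom) (C : List SummaryCode) : List (List (Atom × SummaryCode)) :=
  (as.map fun a => C.map fun c => (a, c)).sections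

theorem mem_boundedLists {m n : ℕ} {l : List ℕ} :
    l ∈ boundedLists m n ↔ l.length = n ∧ ∀ a ∈ l, a < m := by
  rw [boundedLists, List.mem_sections]
  induction n generalizing l with
  | zero => simp +contextual [List.length_eq_zero_iff]
  | succ n ih =>
    have h : (List.range (n + 1)).map (fun _ => List.range m) =
        List.range m :: (List.range n).map fun _ => List.range m := by
      simp [List.map_const', List.replicate_succ]
    rw [h]
    cases l with
    | nil => simp
    | cons a l =>
      simp only [List.forall₂_cons, ih, List.mem_range, List.length_cons,
        Nat.add_right_cancel_iff, List.forall_mem_cons, and_left_comm]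

theorem mem_finiteAtomList {N : ℕ} {g : GroundAtom} :
    g ∈ finiteAtomList N ↔ g ∈ finiteAtoms N := by
  obtain ⟨p, l⟩ := g
  simp only [finiteAtomList, List.mem_flatMap, List.mem_range, List.mem_map, mem_boundedLists,
    Prod.mk.injEq, finiteAtoms, Set.mem_ofPred_eq]
  constructor
  · rintro ⟨p, hp, n, hn, l, ⟨rfl, hl⟩, rfl, rfl⟩
    exact ⟨hp, hn, hl⟩
  · rintro ⟨hp, hn, hl⟩
    exact ⟨p, hp, _, hn, l, ⟨rfl, hl⟩, rfl, rfl⟩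

theorem mem_assignments {as : List Atom} {C : List SummaryCode} {σ : List (Atom × SummaryCode)} :
    σ ∈ assignments as C ↔ σ.map Prod.fst = as ∧ ∀ p ∈ σ, p.2 ∈ C := by
  rw [assignments, List.mem_sections]
  induction as generalizing σ with
  | nil => simp +contextual
  | cons a as ih =>
    cases σ with
    | nil => simp
    | cons p σ =>
      obtain ⟨b, c⟩ := p
      simp only [List.map_cons, List.forall₂_cons, ih, List.mem_map, Prod.mk.injEq,
        List.cons.injEq, List.forall_mem_cons]
      constructor
      · rintro ⟨⟨c, hc, rfl, rfl⟩, h1, h2⟩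
        exact ⟨⟨rfl, h1⟩, hc, h2⟩
      · rintro ⟨⟨rfl, h1⟩, hc, h2⟩
        exact ⟨⟨_, hc, rfl, rfl⟩, h1, h2⟩

/-- The summary of firing a rule in the finite universe, if the new constraints are processed with
coded summaries. -/
def codedNode (N : ℕ) (r : Rule) (σ : List (Atom × SummaryCode)) : Summary :=
  nodeSummary (finiteValuations N) r (σ.map fun p => (p.1, p.2.toSummary))

/-- The list `C` proves that the goal has no terminating computation: it contains a code of the
summary of every plan, since it is closed under the construction of plans, and no choice of
summaries from `C` makes the goal terminate. -/
def Refutes (P : Program) (G : Goal) (N : ℕ) (C : List SummaryCode) : Prop :=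
  (0 < N ∧ (∀ r ∈ P, r.Bdd N) ∧ (goalRule G).Bdd N) ∧
  (∃ c ∈ C, c.toSummary.AgreeOn (finiteAtoms N) (leafSummary (finiteValuations N) P)) ∧
  (∀ r ∈ P, ∀ σ ∈ assignments r.children C, ∃ c ∈ C,
    c.toSummary.AgreeOn (finiteAtoms N) (codedNode N r σ)) ∧
  ∀ σ ∈ assignments (goalRule G).children C, ¬ (codedNode N (goalRule G) σ).Terminates (0, [])

/-- Codes for the summaries of the subtrees of a node form one of the assignments. The second half
exposes both lists as images of one list, as `nodeSummary_agreeOn_finite` requires. -/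
theorem exists_assignment {as : List Atom} {C : List SummaryCode} {F : Plan → Summary}
    {A : Set GroundAtom} {T : ℕ → Plan} (h : ∀ i, ∃ c ∈ C, c.toSummary.AgreeOn A (F (T i))) :
    ∃ σ ∈ assignments as C, ∃ l : List (Atom × ℕ), (∀ p ∈ l, p.1 ∈ as) ∧
      ∃ c : ℕ → SummaryCode, (∀ i, (c i).toSummary.AgreeOn A (F (T i))) ∧
        σ = l.map (fun p => (p.1, c p.2)) ∧
        as.mapIdx (fun i a => (a, T i)) = l.map fun p => (p.1, T p.2) := by
  choose c hc hagree using h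
  refine ⟨as.mapIdx fun i a => (a, c i), mem_assignments.2 ⟨?_, ?_⟩, as.zipIdx, ?_, c,
    hagree, ?_, ?_⟩
  · exact List.ext_getElem (by simp) (by simp)
  · rintro p hp
    obtain ⟨i, hi, rfl⟩ := List.mem_mapIdx.1 hp
    exact hc i
  · rintro ⟨a, i⟩ hp
    exact List.fst_mem_of_mem_zipIdx hp
  · exact List.ext_getElem (by simp) (by simp)
  · exact List.ext_getElem (by simp) (by simp)

/-- If the codes in `C` cover the summaries of the subtrees, then the codes of a node over the
assignments in `C` cover the summary of the node. -/
theorem exists_codedNode_agreeOn {N : ℕ} {P : Program} {C : List SummaryCode} {r : Rule}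
    (hr : r.Bdd N) {T : ℕ → Plan}
    (h : ∀ i, ∃ c ∈ C, c.toSummary.AgreeOn (finiteAtoms N)
      ((T i).summary (finiteValuations N) P)) :
    ∃ σ ∈ assignments r.children C, ∀ A, (codedNode N r σ).AgreeOn A
      ((Plan.node r T).summary (finiteValuations N) P) := by
  obtain ⟨σ, hσ, l, hl, c, hc, rfl, hT⟩ := exists_assignment (as := r.children)
    (F := fun T => T.summary (finiteValuations N) P) h
  refine ⟨_, hσ, fun A => ?_⟩
  rw [Plan.summary_node, hT, codedNode, List.map_map, List.map_map]
  exact nodeSummary_congr r (F := fun i => (c i).toSummary)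
    (F' := fun i => (T i).summary (finiteValuations N) P) (fun p hp => hr.children (hl p hp))
    (fun p _ => hc p.2) A

/-- The codes in a certificate cover all plans. -/
theorem Refutes.exists_code {P : Program} {G : Goal} {N : ℕ} {C : List SummaryCode}
    (h : Refutes P G N C) {T : Plan} (hT : T.Valid P) :
    ∃ c ∈ C, c.toSummary.AgreeOn (finiteAtoms N) (T.summary (finiteValuations N) P) := by
  induction T with
  | leaf => exact h.2.1
  | node r T ih =>
    obtain ⟨σ, hσ, hagree⟩ := exists_codedNode_agreeOn (h.1.2.1 r hT.1) fun i => ih i (hT.2 i)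
    obtain ⟨c, hc, hc'⟩ := h.2.2.1 r hT.1 σ hσ
    exact ⟨c, hc, hc'.trans (hagree _)⟩

/-- Over the finite universe every summary has a code, and the codes come from one finite list. -/
theorem exists_summaryCode (N : ℕ) (s : Summary) :
    ∃ c ∈ ((List.range 3).product (finiteAtomList N)).sublists,
      SummaryCode.toSummary c |>.AgreeOn (finiteAtoms N) s := by
  classical
  let p : ℕ × GroundAtom → Prop := fun x =>
    if x.1 = 0 then s.rests x.2 else if x.1 = 1 then s.stalls x.2 else s.succeeds x.2
  refine ⟨((List.range 3).product (finiteAtomList N)).filter p,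
    List.mem_sublists.2 List.filter_sublist, fun g hg => ?_⟩
  have hg := mem_finiteAtomList.2 hg
  simp [SummaryCode.toSummary, p, List.mem_filter, List.pair_mem_product, hg]

theorem zero_nil_mem_finiteAtoms {N : ℕ} (hN : 0 < N) : ((0, []) : GroundAtom) ∈ finiteAtoms N :=
  ⟨hN, hN, by simp⟩

theorem summary_goal_terminates_iff {N : ℕ} (hN : 0 < N) {P : Program} (hP : ∀ r ∈ P, r.Bdd N)
    {G : Goal} (hG : (goalRule G).Bdd N) {T : ℕ → Plan} (hT : ∀ i, (T i).Valid P) :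
    ((Plan.node (goalRule G) T).summary Set.univ P).Terminates (0, []) ↔
      ((Plan.node (goalRule G) T).summary (finiteValuations N) P).Terminates (0, []) :=
  (Plan.summary_node_agreeOn_finite hP hG hT
    fun i => Plan.summary_agreeOn_finite hP (hT i)).terminates_iff (zero_nil_mem_finiteAtoms hN)

/-- A goal of a single-headed program has no terminating computation if and only if there is a
certificate for this.  The certificate consists of the summaries of all plans, of which there are
finitely many in the finite universe. -/
theorem not_hasTerminatingComputation_iff {P : Program} (hP : P.IsSingleHeaded) (G : Goal) :
    ¬ HasTerminatingComputation P G ↔ ∃ N C, Refutes P G N C := by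
  classical
  rw [hasTerminatingComputation_iff hP]
  constructor
  · intro h
    obtain ⟨N, hN, hPN, hGN⟩ := ((eventually_gt_atTop 0).and
      ((eventually_forall_mem P Rule.eventually_bdd).and (goalRule G).eventually_bdd)).exists
    let C := ((List.range 3).product (finiteAtomList N)).sublists.filter fun c => ∃ T : Plan,
      T.Valid P ∧ (SummaryCode.toSummary c).AgreeOn (finiteAtoms N)
        (T.summary (finiteValuations N) P)
    have hmem : ∀ c ∈ C, ∃ T : Plan, T.Valid P ∧
        (SummaryCode.toSummary c).AgreeOn (finiteAtoms N) (T.summary (finiteValuations N) P) :=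
      fun c hc => by simpa using (List.mem_filter.1 hc).2
    have hex : ∀ T : Plan, T.Valid P → ∃ c ∈ C,
        (SummaryCode.toSummary c).AgreeOn (finiteAtoms N) (T.summary (finiteValuations N) P) := by
      intro T hT
      obtain ⟨c, hc, hc'⟩ := exists_summaryCode N (T.summary (finiteValuations N) P)
      exact ⟨c, List.mem_filter.2 ⟨hc, by simpa using ⟨T, hT, hc'⟩⟩, hc'⟩
    have hσ : ∀ r : Rule, r.Bdd N → ∀ σ ∈ assignments r.children C, ∃ T : ℕ → Plan,
        (∀ i, (T i).Valid P) ∧ ∀ A, (codedNode N r σ).AgreeOn A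
          ((Plan.node r T).summary (finiteValuations N) P) := by
      intro r hr σ hσ
      obtain ⟨h1, h2⟩ := mem_assignments.1 hσ
      have : Nonempty Plan := ⟨.leaf⟩
      choose! T hT hT' using hmem
      have hfst : ∀ p ∈ σ, p.1 ∈ r.children := fun p hp => h1 ▸ List.mem_map_of_mem hp
      let T' : ℕ → Plan := fun i => (σ[i]?.map fun p => T p.2).getD .leaf
      refine ⟨T', fun i => ?_, fun A => ?_⟩
      · by_cases hi : i < σ.length
        · simpa [T', hi] using hT _ (h2 σ[i] (List.getElem_mem hi))
        · simp [T', hi, Plan.Valid]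
      · have : r.children.mapIdx (fun i a => (a, T' i)) = σ.map fun p => (p.1, T p.2) := by
          rw [← h1]
          exact List.ext_getElem (by simp) fun i hi hi' => by
            have : i < σ.length := by simpa using hi'
            simp [T', this]
        rw [Plan.summary_node, this, codedNode, List.map_map]
        exact nodeSummary_congr r (F' := fun c => (T c).summary (finiteValuations N) P)
          (fun p hp => hr.children (hfst p hp)) (fun p hp => hT' _ (h2 p hp)) A
    refine ⟨N, C, ⟨hN, hPN, hGN⟩, hex .leaf trivial, fun r hr σ hσ' => ?_, fun σ hσ' ht => ?_⟩
    · obtain ⟨T, hT, hT'⟩ := hσ r (hPN r hr) σ hσ'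
      obtain ⟨c, hc, hc'⟩ := hex (.node r T) ⟨hr, hT⟩
      exact ⟨c, hc, hc'.trans (hT' _).symm⟩
    · obtain ⟨T, hT, hT'⟩ := hσ _ hGN σ hσ'
      refine h ⟨T, hT, (summary_goal_terminates_iff hN hPN hGN hT).2 ?_⟩
      exact ((hT' Set.univ).terminates_iff trivial).1 ht
  · rintro ⟨N, C, h⟩ ⟨T, hT, ht⟩
    obtain ⟨hN, hPN, hGN⟩ := h.1
    obtain ⟨σ, hσ, hagree⟩ := exists_codedNode_agreeOn hGN fun i => h.exists_code (hT i)
    refine h.2.2.2 σ hσ (((hagree Set.univ).terminates_iff trivial).2 ?_)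
    exact (summary_goal_terminates_iff hN hPN hGN hT).1 ht

end CHR

/-! ### Certificates can be checked -/

namespace CHR

section Quantifiers

variable {α β : Type*} [Primcodable α] [Primcodable β]

theorem primrecPred_forall_mem {f : α → List β} {R : α → β → Prop} (hf : Primrec f)
    (hR : PrimrecPred fun p : α × β => R p.1 p.2) : PrimrecPred fun a => ∀ b ∈ f a, R a b := by
  have h : PrimrecRel fun (b : β) (a : α) => R a b :=
    PrimrecPred.comp (p := fun p : α × β => R p.1 p.2) hR (Primrec.pair Primrec.snd Primrec.fst)
  exact h.forall_mem_list.comp hf Primrec.id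

theorem primrecPred_exists_mem {f : α → List β} {R : α → β → Prop} (hf : Primrec f)
    (hR : PrimrecPred fun p : α × β => R p.1 p.2) : PrimrecPred fun a => ∃ b ∈ f a, R a b := by
  have h : PrimrecRel fun (b : β) (a : α) => R a b :=
    PrimrecPred.comp (p := fun p : α × β => R p.1 p.2) hR (Primrec.pair Primrec.snd Primrec.fst)
  exact h.exists_mem_list.comp hf Primrec.id

theorem primrecPred_imp {p q : α → Prop} (hp : PrimrecPred p) (hq : PrimrecPred q) :
    PrimrecPred fun a => p a → q a :=
  (hp.not.or hq).of_eq fun _ => imp_iff_not_or.symm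

theorem primrecPred_iff {p q : α → Prop} (hp : PrimrecPred p) (hq : PrimrecPred q) :
    PrimrecPred fun a => (p a ↔ q a) :=
  ((primrecPred_imp hp hq).and (primrecPred_imp hq hp)).of_eq fun _ =>
    iff_iff_implies_and_implies.symm

theorem primrecPred_mem {f : α → β} {g : α → List β} (hf : Primrec f) (hg : Primrec g) :
    PrimrecPred fun a => f a ∈ g a :=
  (primrecPred_exists_mem (R := fun a b => b = f a) hg
    (Primrec.eq.comp Primrec.snd (hf.comp Primrec.fst))).of_eq fun a => by simp

theorem primrec_sections : Primrec (List.sections : List (List β) → List (List β)) := by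
  have h := Primrec.list_foldr (f := fun L : List (List β) => L) (g := fun _ => [[]])
    (h := fun _ p => p.2.flatMap fun s => p.1.map fun a => a :: s) Primrec.id (Primrec.const _) ?_
  · refine h.of_eq fun L => ?_
    induction L with
    | nil => rfl
    | cons l L ih => rw [List.foldr_cons, ih, List.sections]
  · refine Primrec.list_flatMap (Primrec.snd.comp Primrec.snd) ?_
    refine Primrec.list_map (Primrec.fst.comp (Primrec.snd.comp Primrec.fst)) ?_
    exact Primrec.list_cons.comp Primrec.snd (Primrec.snd.comp Primrec.fst)

end Quantifiers

theorem primrec_termEquiv : Primrec termEquiv := Primrec.of_equiv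

theorem primrec_equationEquiv : Primrec equationEquiv := Primrec.of_equiv

theorem primrec_atomEquiv : Primrec atomEquiv := Primrec.of_equiv

theorem primrec_constraintEquiv : Primrec constraintEquiv := Primrec.of_equiv

theorem primrec_ruleEquiv : Primrec ruleEquiv := Primrec.of_equiv

theorem primrec_lhs : Primrec Equation.lhs := Primrec.fst.comp primrec_equationEquiv

theorem primrec_rhs : Primrec Equation.rhs := Primrec.snd.comp primrec_equationEquiv

theorem primrec_pred : Primrec Atom.pred := Primrec.fst.comp primrec_atomEquiv

theorem primrec_args : Primrec Atom.args := Primrec.snd.comp primrec_atomEquiv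

theorem primrec_keep : Primrec Rule.keep := Primrec.fst.comp primrec_ruleEquiv

theorem primrec_remove : Primrec Rule.remove :=
  (Primrec.fst.comp Primrec.snd).comp primrec_ruleEquiv

theorem primrec_guard : Primrec Rule.guard :=
  (Primrec.fst.comp (Primrec.snd.comp Primrec.snd)).comp primrec_ruleEquiv

theorem primrec_body : Primrec Rule.body :=
  (Primrec.snd.comp (Primrec.snd.comp Primrec.snd)).comp primrec_ruleEquiv

theorem primrec_heads : Primrec Rule.heads := Primrec.list_append.comp primrec_keep primrec_remove

theorem primrec_atom? : Primrec Constraint.atom? := by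
  refine (Primrec.sumCasesOn primrec_constraintEquiv (g := fun _ _ => none)
    (h := fun _ a => some a) (Primrec.const none) (Primrec.option_some.comp Primrec.snd)).of_eq ?_
  intro c
  cases c <;> rfl

theorem primrec_eqn? : Primrec Constraint.eqn? := by
  refine (Primrec.sumCasesOn primrec_constraintEquiv (g := fun _ e => some e)
    (h := fun _ _ => none) (Primrec.option_some.comp Primrec.snd) (Primrec.const none)).of_eq ?_
  intro c
  cases c <;> rfl

theorem primrec_bodyAtoms : Primrec Rule.bodyAtoms :=
  Primrec.listFilterMap primrec_body (primrec_atom?.comp Primrec.snd)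

theorem primrec_bodyEqs : Primrec Rule.bodyEqs :=
  Primrec.listFilterMap primrec_body (primrec_eqn?.comp Primrec.snd)

theorem primrec_children : Primrec Rule.children :=
  Primrec.list_append.comp primrec_keep primrec_bodyAtoms

theorem primrec_goalRule : Primrec goalRule := by
  have h : Primrec fun G : Goal => ruleEquiv.symm ([], [], [], G) :=
    (Primrec.of_equiv_symm (e := ruleEquiv)).comp (Primrec.pair (Primrec.const [])
      (Primrec.pair (Primrec.const []) (Primrec.pair (Primrec.const []) Primrec.id)))
  exact h

/-- The valuation given by the list of its values, completed by zeros. -/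
def listValuation (l : List ℕ) : Valuation := fun x => l.getD x 0

theorem exists_finiteValuations_iff (N : ℕ) (Q : Valuation → Prop) :
    (∃ w ∈ finiteValuations N, Q w) ↔ ∃ l ∈ boundedLists (2 * N) N, Q (listValuation l) := by
  constructor
  · rintro ⟨w, ⟨h1, h2⟩, hQ⟩
    have : listValuation ((List.range N).map w) = w := by
      funext x
      by_cases hx : x < N
      · simp [listValuation, hx]
      · simp [listValuation, hx, h2 x (Nat.not_lt.1 hx)]
    refine ⟨(List.range N).map w, mem_boundedLists.2 ⟨by simp, ?_⟩, this.symm ▸ hQ⟩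
    intro a ha
    obtain ⟨x, hx, rfl⟩ := List.mem_map.1 ha
    exact h1 x (List.mem_range.1 hx)
  · rintro ⟨l, hl, hQ⟩
    obtain ⟨rfl, hl⟩ := mem_boundedLists.1 hl
    refine ⟨_, ⟨fun x hx => ?_, fun x hx => ?_⟩, hQ⟩
    · rw [listValuation, List.getD_eq_getElem _ _ hx]
      exact hl _ (List.getElem_mem hx)
    · rw [listValuation, List.getD_eq_default _ _ hx]

theorem primrec_eval : Primrec fun p : List ℕ × Term => p.2.eval (listValuation p.1) := by
  refine (Primrec.sumCasesOn (primrec_termEquiv.comp Primrec.snd)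
    (g := fun (p : List ℕ × Term) x => p.1.getD x 0) (h := fun _ a => a)
    ((Primrec.list_getD 0).comp (Primrec.fst.comp Primrec.fst) Primrec.snd) Primrec.snd).of_eq ?_
  rintro ⟨l, t⟩
  cases t <;> rfl

theorem primrec_ground : Primrec fun p : List ℕ × Atom => p.2.ground (listValuation p.1) :=
  Primrec.pair (primrec_pred.comp Primrec.snd)
    (Primrec.list_map (primrec_args.comp Primrec.snd)
      (primrec_eval.comp (Primrec.pair (Primrec.fst.comp Primrec.fst) Primrec.snd)))

theorem primrecPred_satisfies :
    PrimrecPred fun p : List ℕ × List Equation => (listValuation p.1).Satisfies p.2 :=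
  primrecPred_forall_mem Primrec.snd
    (Primrec.eq.comp
      (primrec_eval.comp (Primrec.pair (Primrec.fst.comp Primrec.fst)
        (primrec_lhs.comp Primrec.snd)))
      (primrec_eval.comp (Primrec.pair (Primrec.fst.comp Primrec.fst)
        (primrec_rhs.comp Primrec.snd))))

theorem primrec_boundedLists : Primrec fun p : ℕ × ℕ => boundedLists p.1 p.2 :=
  primrec_sections.comp (Primrec.list_map (Primrec.list_range.comp Primrec.snd)
    (Primrec.list_range.comp (Primrec.fst.comp Primrec.fst)))

theorem primrec_finiteAtomList : Primrec finiteAtomList := by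
  refine Primrec.list_flatMap Primrec.list_range ?_
  refine Primrec.list_flatMap (Primrec.list_range.comp Primrec.fst) ?_
  refine Primrec.list_map (primrec_boundedLists.comp (Primrec.pair ?_ Primrec.snd)) ?_
  · exact Primrec.nat_mul.comp (Primrec.const 2) (Primrec.fst.comp Primrec.fst)
  · exact Primrec.pair (Primrec.snd.comp (Primrec.fst.comp Primrec.fst)) Primrec.snd

theorem primrec_assignments :
    Primrec fun p : List Atom × List SummaryCode => assignments p.1 p.2 :=
  primrec_sections.comp (Primrec.list_map Primrec.fst (Primrec.list_map
    (Primrec.snd.comp Primrec.fst) (Primrec.pair (Primrec.snd.comp Primrec.fst) Primrec.snd)))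

theorem primrecPred_heads : PrimrecPred fun p : (Rule × GroundAtom) × List ℕ =>
    ∀ h ∈ p.1.1.heads, h.ground (listValuation p.2) = p.1.2 :=
  primrecPred_forall_mem (primrec_heads.comp (Primrec.fst.comp Primrec.fst))
    (Primrec.eq.comp (primrec_ground.comp (Primrec.pair (Primrec.snd.comp Primrec.fst) Primrec.snd))
      (Primrec.snd.comp (Primrec.fst.comp Primrec.fst)))

theorem primrecPred_fires : PrimrecPred fun p : (Rule × GroundAtom) × List ℕ =>
    p.1.1.Fires p.1.2 (listValuation p.2) :=
  primrecPred_heads.and (primrecPred_satisfies.comp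
    (Primrec.pair Primrec.snd (primrec_bodyEqs.comp (Primrec.fst.comp Primrec.fst))))

theorem primrec_finiteLists : Primrec fun N => boundedLists (2 * N) N :=
  primrec_boundedLists.comp
    (Primrec.pair (Primrec.nat_mul.comp (Primrec.const 2) Primrec.id) Primrec.id)

theorem primrecPred_enabled : PrimrecPred fun p : ℕ × Rule × GroundAtom =>
    p.2.1.Enabled (finiteValuations p.1) p.2.2 := by
  refine (primrecPred_exists_mem (f := fun p : ℕ × Rule × GroundAtom => boundedLists (2 * p.1) p.1)
    (R := fun p l => (∀ h ∈ p.2.1.heads, h.ground (listValuation l) = p.2.2) ∧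
      (listValuation l).Satisfies p.2.1.guard) (primrec_finiteLists.comp Primrec.fst) ?_).of_eq
    fun p => (exists_finiteValuations_iff p.1 fun w =>
      (∀ h ∈ p.2.1.heads, h.ground w = p.2.2) ∧ w.Satisfies p.2.1.guard).symm
  refine PrimrecPred.and (primrecPred_heads.comp (Primrec.pair (Primrec.snd.comp Primrec.fst)
    Primrec.snd)) (primrecPred_satisfies.comp (Primrec.pair Primrec.snd ?_))
  exact primrec_guard.comp (Primrec.fst.comp (Primrec.snd.comp Primrec.fst))

/-- The arguments on which a rule application in the finite universe depends. -/
abbrev NodeData := (ℕ × Rule × GroundAtom) × List (Atom × SummaryCode)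

theorem primrecPred_tagged (i : ℕ) : PrimrecPred fun p : List ℕ × (Atom × SummaryCode) =>
    (i, p.2.1.ground (listValuation p.1)) ∈ p.2.2 :=
  primrecPred_mem (Primrec.pair (Primrec.const i) (primrec_ground.comp
    (Primrec.pair Primrec.fst (Primrec.fst.comp Primrec.snd)))) (Primrec.snd.comp Primrec.snd)

theorem primrecPred_forall_tagged (i : ℕ) : PrimrecPred fun p : NodeData × List ℕ =>
    ∀ q ∈ p.1.2, (i, q.1.ground (listValuation p.2)) ∈ q.2 :=
  primrecPred_forall_mem (Primrec.snd.comp Primrec.fst)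
    ((primrecPred_tagged i).comp (Primrec.pair (Primrec.snd.comp Primrec.fst) Primrec.snd))

theorem primrecPred_exists_tagged (i : ℕ) : PrimrecPred fun p : NodeData × List ℕ =>
    ∃ q ∈ p.1.2, (i, q.1.ground (listValuation p.2)) ∈ q.2 :=
  primrecPred_exists_mem (Primrec.snd.comp Primrec.fst)
    ((primrecPred_tagged i).comp (Primrec.pair (Primrec.snd.comp Primrec.fst) Primrec.snd))

theorem primrecPred_exists_fires {Q : NodeData × List ℕ → Prop} (hQ : PrimrecPred Q) :
    PrimrecPred fun p : NodeData => ∃ l ∈ boundedLists (2 * p.1.1) p.1.1,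
      p.1.2.1.Fires p.1.2.2 (listValuation l) ∧ Q (p, l) :=
  primrecPred_exists_mem (primrec_finiteLists.comp (Primrec.fst.comp Primrec.fst))
    ((primrecPred_fires.comp (Primrec.pair
      (Primrec.snd.comp (Primrec.fst.comp Primrec.fst)) Primrec.snd)).and hQ)

theorem primrecPred_rests :
    PrimrecPred fun p : NodeData => (codedNode p.1.1 p.1.2.1 p.2).rests p.1.2.2 := by
  refine (primrecPred_imp (primrecPred_enabled.comp Primrec.fst)
    (primrecPred_exists_fires (primrecPred_forall_tagged 0))).of_eq fun p => ?_
  simp only [codedNode, nodeSummary, exists_finiteValuations_iff, List.forall_mem_map,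
    SummaryCode.toSummary]

theorem primrecPred_stalls :
    PrimrecPred fun p : NodeData => (codedNode p.1.1 p.1.2.1 p.2).stalls p.1.2.2 := by
  refine ((primrecPred_enabled.comp Primrec.fst).not.or (primrecPred_exists_fires
    ((primrecPred_forall_tagged 0).and (primrecPred_exists_tagged 1)))).of_eq fun p => ?_
  simp only [codedNode, nodeSummary, exists_finiteValuations_iff, List.forall_mem_map]
  simp only [List.mem_map, exists_exists_and_eq_and, SummaryCode.toSummary]

theorem primrecPred_succeeds :
    PrimrecPred fun p : NodeData => (codedNode p.1.1 p.1.2.1 p.2).succeeds p.1.2.2 := by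
  refine ((primrecPred_enabled.comp Primrec.fst).and
    (primrecPred_exists_fires (primrecPred_forall_tagged 2))).of_eq fun p => ?_
  simp only [codedNode, nodeSummary, exists_finiteValuations_iff, List.forall_mem_map,
    SummaryCode.toSummary]

theorem primrecPred_agreeOn_node :
    PrimrecPred fun p : (ℕ × Rule × List (Atom × SummaryCode)) × SummaryCode =>
      p.2.toSummary.AgreeOn (finiteAtoms p.1.1) (codedNode p.1.1 p.1.2.1 p.1.2.2) := by
  have hd : Primrec fun q : ((ℕ × Rule × List (Atom × SummaryCode)) × SummaryCode) × GroundAtom =>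
      (((q.1.1.1, q.1.1.2.1, q.2), q.1.1.2.2) : NodeData) :=
    Primrec.pair (Primrec.pair (Primrec.fst.comp (Primrec.fst.comp Primrec.fst))
      (Primrec.pair (Primrec.fst.comp (Primrec.snd.comp (Primrec.fst.comp Primrec.fst)))
        Primrec.snd)) (Primrec.snd.comp (Primrec.snd.comp (Primrec.fst.comp Primrec.fst)))
  have ht : ∀ i : ℕ, PrimrecPred fun q : ((ℕ × Rule × List (Atom × SummaryCode)) × SummaryCode) ×
      GroundAtom => (i, q.2) ∈ q.1.2 := fun i =>
    primrecPred_mem (Primrec.pair (Primrec.const i) Primrec.snd) (Primrec.snd.comp Primrec.fst)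
  refine (primrecPred_forall_mem
    (R := fun (p : (ℕ × Rule × List (Atom × SummaryCode)) × SummaryCode) g =>
      (p.2.toSummary.rests g ↔ (codedNode p.1.1 p.1.2.1 p.1.2.2).rests g) ∧
      (p.2.toSummary.stalls g ↔ (codedNode p.1.1 p.1.2.1 p.1.2.2).stalls g) ∧
      (p.2.toSummary.succeeds g ↔ (codedNode p.1.1 p.1.2.1 p.1.2.2).succeeds g))
    (primrec_finiteAtomList.comp (Primrec.fst.comp Primrec.fst))
    ((primrecPred_iff (ht 0) (primrecPred_rests.comp hd)).and
      ((primrecPred_iff (ht 1) (primrecPred_stalls.comp hd)).and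
        (primrecPred_iff (ht 2) (primrecPred_succeeds.comp hd))))).of_eq fun p => ?_
  simp only [mem_finiteAtomList]
  rfl

theorem primrecPred_agreeOn_leaf :
    PrimrecPred fun p : (ℕ × Program) × SummaryCode =>
      p.2.toSummary.AgreeOn (finiteAtoms p.1.1) (leafSummary (finiteValuations p.1.1) p.1.2) := by
  have ht : ∀ i : ℕ, PrimrecPred fun q : ((ℕ × Program) × SummaryCode) × GroundAtom =>
      (i, q.2) ∈ q.1.2 := fun i =>
    primrecPred_mem (Primrec.pair (Primrec.const i) Primrec.snd) (Primrec.snd.comp Primrec.fst)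
  have hdead : PrimrecPred fun q : ((ℕ × Program) × SummaryCode) × GroundAtom =>
      ∀ r ∈ q.1.1.2, ¬ r.Enabled (finiteValuations q.1.1.1) q.2 := by
    refine primrecPred_forall_mem (Primrec.snd.comp (Primrec.fst.comp Primrec.fst))
      (primrecPred_enabled.comp (Primrec.pair ?_ (Primrec.pair Primrec.snd ?_))).not
    · exact Primrec.fst.comp (Primrec.fst.comp (Primrec.fst.comp Primrec.fst))
    · exact Primrec.snd.comp Primrec.fst
  refine (primrecPred_forall_mem (R := fun (p : (ℕ × Program) × SummaryCode) g =>
      (0, g) ∈ p.2 ∧ (1, g) ∉ p.2 ∧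
        ((2, g) ∈ p.2 ↔ ∀ r ∈ p.1.2, ¬ r.Enabled (finiteValuations p.1.1) g))
    (primrec_finiteAtomList.comp (Primrec.fst.comp Primrec.fst))
    ((ht 0).and ((ht 1).not.and (primrecPred_iff (ht 2) hdead)))).of_eq fun p => ?_
  simp only [mem_finiteAtomList, Summary.AgreeOn, SummaryCode.toSummary, leafSummary, iff_true,
    iff_false]

theorem primrecPred_terminates :
    PrimrecPred fun p : (ℕ × Rule) × List (Atom × SummaryCode) =>
      (codedNode p.1.1 p.1.2 p.2).Terminates (0, []) := by
  have hd : Primrec fun p : (ℕ × Rule) × List (Atom × SummaryCode) =>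
      (((p.1.1, p.1.2, (0, [])), p.2) : NodeData) :=
    Primrec.pair (Primrec.pair (Primrec.fst.comp Primrec.fst)
      (Primrec.pair (Primrec.snd.comp Primrec.fst) (Primrec.const _))) Primrec.snd
  exact (primrecPred_stalls.comp hd).not.and
    (primrecPred_imp (primrecPred_rests.comp hd) (primrecPred_succeeds.comp hd))

theorem primrecPred_term_bdd : PrimrecPred fun p : ℕ × Term => p.2.Bdd p.1 := by
  have h : Primrec fun p : ℕ × Term => Sum.elim id id (termEquiv p.2) := by
    refine (Primrec.sumCasesOn (primrec_termEquiv.comp Primrec.snd)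
      (g := fun (_ : ℕ × Term) x => x) (h := fun _ a => a) Primrec.snd Primrec.snd).of_eq ?_
    rintro ⟨l, t⟩
    cases t <;> rfl
  refine (Primrec.nat_lt.comp h Primrec.fst).of_eq ?_
  rintro ⟨N, t⟩
  cases t <;> rfl

theorem primrecPred_equation_bdd : PrimrecPred fun p : ℕ × Equation => p.2.Bdd p.1 :=
  (primrecPred_term_bdd.comp (Primrec.pair Primrec.fst (primrec_lhs.comp Primrec.snd))).and
    (primrecPred_term_bdd.comp (Primrec.pair Primrec.fst (primrec_rhs.comp Primrec.snd)))

theorem primrecPred_atom_bdd : PrimrecPred fun p : ℕ × Atom => p.2.Bdd p.1 :=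
  (Primrec.nat_lt.comp (primrec_pred.comp Primrec.snd) Primrec.fst).and
    ((Primrec.nat_lt.comp (Primrec.list_length.comp (primrec_args.comp Primrec.snd))
      Primrec.fst).and (primrecPred_forall_mem (primrec_args.comp Primrec.snd)
        (primrecPred_term_bdd.comp (Primrec.pair (Primrec.fst.comp Primrec.fst) Primrec.snd))))

theorem primrecPred_rule_bdd : PrimrecPred fun p : ℕ × Rule => p.2.Bdd p.1 := by
  have hatom : ∀ {f : Rule → List Atom}, Primrec f →
      PrimrecPred fun p : ℕ × Rule => ∀ a ∈ f p.2, a.Bdd p.1 := fun hf =>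
    primrecPred_forall_mem (hf.comp Primrec.snd)
      (primrecPred_atom_bdd.comp (Primrec.pair (Primrec.fst.comp Primrec.fst) Primrec.snd))
  have heqn : ∀ {f : Rule → List Equation}, Primrec f →
      PrimrecPred fun p : ℕ × Rule => ∀ e ∈ f p.2, e.Bdd p.1 := fun hf =>
    primrecPred_forall_mem (hf.comp Primrec.snd)
      (primrecPred_equation_bdd.comp (Primrec.pair (Primrec.fst.comp Primrec.fst) Primrec.snd))
  exact (hatom primrec_heads).and ((heqn primrec_guard).and ((heqn primrec_bodyEqs).and
    (hatom primrec_bodyAtoms)))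

theorem primrecPred_refutes :
    PrimrecPred fun p : (Program × Goal) × (ℕ × List SummaryCode) =>
      Refutes p.1.1 p.1.2 p.2.1 p.2.2 := by
  have hP : Primrec fun p : (Program × Goal) × (ℕ × List SummaryCode) => p.1.1 :=
    Primrec.fst.comp Primrec.fst
  have hG : Primrec fun p : (Program × Goal) × (ℕ × List SummaryCode) => goalRule p.1.2 :=
    primrec_goalRule.comp (Primrec.snd.comp Primrec.fst)
  have hN : Primrec fun p : (Program × Goal) × (ℕ × List SummaryCode) => p.2.1 :=
    Primrec.fst.comp Primrec.snd
  have hC : Primrec fun p : (Program × Goal) × (ℕ × List SummaryCode) => p.2.2 :=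
    Primrec.snd.comp Primrec.snd
  refine PrimrecPred.and (PrimrecPred.and ?_ (PrimrecPred.and ?_ ?_))
    (PrimrecPred.and ?_ (PrimrecPred.and ?_ ?_))
  · exact Primrec.nat_lt.comp (Primrec.const 0) hN
  · exact primrecPred_forall_mem hP (primrecPred_rule_bdd.comp
      (Primrec.pair (hN.comp Primrec.fst) Primrec.snd))
  · exact primrecPred_rule_bdd.comp (Primrec.pair hN hG)
  · exact primrecPred_exists_mem hC (primrecPred_agreeOn_leaf.comp
      (Primrec.pair ((Primrec.pair hN hP).comp Primrec.fst) Primrec.snd))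
  · refine primrecPred_forall_mem hP (primrecPred_forall_mem
      (R := fun (q : ((Program × Goal) × (ℕ × List SummaryCode)) × Rule) σ => ∃ c ∈ q.1.2.2,
        c.toSummary.AgreeOn (finiteAtoms q.1.2.1) (codedNode q.1.2.1 q.2 σ))
      (primrec_assignments.comp (Primrec.pair
        (primrec_children.comp Primrec.snd) (hC.comp Primrec.fst)))
      (primrecPred_exists_mem (hC.comp (Primrec.fst.comp Primrec.fst))
        (primrecPred_agreeOn_node.comp (Primrec.pair (Primrec.pair ?_ (Primrec.pair ?_ ?_))
          Primrec.snd))))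
    · exact hN.comp (Primrec.fst.comp (Primrec.fst.comp Primrec.fst))
    · exact Primrec.snd.comp (Primrec.fst.comp Primrec.fst)
    · exact Primrec.snd.comp Primrec.fst
  · exact primrecPred_forall_mem (primrec_assignments.comp
      (Primrec.pair (primrec_children.comp hG) hC))
      (primrecPred_terminates.comp
        (Primrec.pair ((Primrec.pair hN hG).comp Primrec.fst) Primrec.snd)).not

theorem computablePred_comp {α β : Type*} [Primcodable α] [Primcodable β] {p : β → Prop}
    {f : α → β} (hp : ComputablePred p) (hf : Computable f) : ComputablePred fun a => p (f a) := by
  obtain ⟨hdec, hp⟩ := hp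
  exact ⟨fun a => hdec (f a), hp.comp hf⟩

/-- Existential quantification over a countable type leads to recursively enumerable predicates. -/
theorem rePred_exists {α β : Type*} [Primcodable α] [Primcodable β] {R : α × β → Prop}
    (hR : ComputablePred R) : REPred fun a => ∃ b, R (a, b) := by
  obtain ⟨hdec, hR⟩ := hR
  have hf : Computable₂ fun (a : α) (n : ℕ) =>
      ((Encodable.decode (α := β) n).map fun b => decide (R (a, b))).getD false := by
    refine Computable.option_getD (Computable.option_map
      (Computable.decode.comp Computable.snd) ?_) (Computable.const false)
    exact hR.comp (Computable.pair (Computable.fst.comp Computable.fst) Computable.snd)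
  refine (Partrec.rfind hf.partrec₂).dom_re.of_eq fun a => ?_
  simp only [Nat.rfind_dom, PFun.coe_val, Part.mem_some_iff, Part.some_dom, implies_true, and_true]
  constructor
  · rintro ⟨n, hn⟩
    cases hb : Encodable.decode (α := β) n with
    | none => simp [hb] at hn
    | some b => exact ⟨b, by simpa [hb] using hn⟩
  · rintro ⟨b, hb⟩
    exact ⟨Encodable.encode b, by simpa using hb⟩

/-- The goals without terminating computation are recursively enumerable, even for programs that
are given together with them. -/
theorem rePred_not_hasTerminatingComputation {α : Type*} [Primcodable α]
    {f : α → Program × Goal} (hf : Computable f) (hP : ∀ a, (f a).1.IsSingleHeaded) :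
    REPred fun a => ¬ HasTerminatingComputation (f a).1 (f a).2 := by
  have h := computablePred_comp primrecPred_refutes.computablePred
    ((hf.comp Computable.fst).pair (Computable.snd (α := α) (β := ℕ × List SummaryCode)))
  refine (rePred_exists h).of_eq fun a => ?_
  rw [Prod.exists, not_hasTerminatingComputation_iff (hP a)]

end CHR

theorem mainTheorem4 :
    ¬ ∃ f : CHR.TuringMachine × List ℕ → CHR.Program × CHR.Goal,
      Computable f ∧
      (∀ x, CHR.Program.IsSingleHeaded (f x).1) ∧
      CHR.IsWeakTerminationPreserving f := by
  rintro ⟨f, hf, hsingle, hpres⟩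
  obtain ⟨Z, D, hD, hZ⟩ := CHR.exists_universal_machine
  refine ComputablePred.halting_problem_not_re 0 ?_
  refine (CHR.rePred_not_hasTerminatingComputation (hf.comp ((Computable.const Z).pair hD))
    fun c => hsingle (Z, D c)).of_eq fun c => ?_
  rw [← hpres, hZ]
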